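/- Let $(Z_{ij})_{i,j\ge 1}$ be an infinite array of complex random variables on a probability space such that, for every $n\ge 1$, the $n\times n$ matrix $Z_n=[Z_{ij}]_{i,j=1}^n$ is Hermitian. Assume that the variables $(Z_{ij})_{i\le j}$ are independent and centred, that $$\sup_{1\le i<j}\mathbb{E}\left(|Z_{ij}|^3\right)<+\infty,$$ and that there exist a real number $K>0$, a nonnegative random variable $Y$ (possibly on another probability space) with $\mathbb{E}(Y^4)<+\infty$, a real number $x_0>0$ and an integer $n_0>0$ such that, for every real $x>x_0$ and every integer $n>n_0$, $$\frac{1}{n^2}\sum_{1\le i,j\le n}\mathbb{P}\left(|Z_{ij}|>x\right)\le K\,\mathbb{P}(Y>x).$$ Set $\sigma^*=\left\{\sup_{1\le i<j}\mathbb{E}\left(|Z_{ij}|^2\right)\right\}^{1/2}$. Then, almost surely, $$\limsup_{n\to+\infty}\left\|\frac{Z_n}{\sqrt n}\right\|\le 2\sigma^*,$$ where $\|\cdot\|$ denotes the spectral norm. -/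

import Mathlib

open MeasureTheory ProbabilityTheory Filter

/-- The `n × n` upper-left corner, at the outcome `ω`, of an infinite array of complex random
variables (rows and columns are numbered from `0`). -/
def cornerMatrix {Ω : Type*} (Z : ℕ → ℕ → Ω → ℂ) (n : ℕ) (ω : Ω) : Matrix (Fin n) (Fin n) ℂ :=
  Matrix.of fun i j => Z i j ω

/-- The spectral norm of a complex square matrix: the operator norm of the linear map it induces
on `ℂⁿ` with its Euclidean norm. -/
noncomputable def matrixSpectralNorm {n : ℕ} (A : Matrix (Fin n) (Fin n) ℂ) : ℝ :=
  ‖Matrix.toEuclideanCLM (n := Fin n) (𝕜 := ℂ) A‖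

/-- `sup_{i < j} E |Z i j| ^ p`, as an element of `[0, ∞]`. -/
noncomputable def supOffDiagMoment {Ω : Type*} [MeasurableSpace Ω] (P : Measure Ω)
    (Z : ℕ → ℕ → Ω → ℂ) (p : ℕ) : ENNReal :=
  ⨆ (i : ℕ) (j : ℕ) (_ : i < j), ∫⁻ ω, ‖Z i j ω‖ₑ ^ p ∂P

/-- `σ* = (sup_{i < j} E |Z i j| ^ 2) ^ (1/2)`, as an element of `[0, ∞]`. -/
noncomputable def sigmaStar {Ω : Type*} [MeasurableSpace Ω] (P : Measure Ω)
    (Z : ℕ → ℕ → Ω → ℂ) : ENNReal :=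
  (supOffDiagMoment P Z 2) ^ (1 / 2 : ℝ)

/-!
The array is cut at the level `τ = n ^ (2 / 5)`. Off the diagonal, `Z i j` is the sum of the
recentred truncation of `Z i j` at `τ`, the mean of that truncation, and the part above `τ`.

The last two parts and the diagonal are handled by Schur's test
(`matrixSpectralNorm_cornerMatrix_le`). The means are at most `C / τ ^ 2`, as `Z i j` is centred
and has third moment at most `C`. The probability that an off-diagonal entry exceeds `τ` is at most
`C / τ ^ 3 = C n ^ (-6 / 5)`, so a union bound over `15`-element sets shows that almost surely, for
large `n`, no row contains more than `14` such entries (`ae_eventually_card_large_le`). Finally, all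
entries of the `n × n` corner are `o(√n)`: this is a Borel-Cantelli argument along `n = 2 ^ k`, and
it is where the fourth moment of `Y` enters (`ae_eventually_norm_le_mul_sqrt`). The row sums of all
these parts together are therefore `o(√n)`.

The main part `X` has independent centred entries bounded by `2 τ`, with second moments at most
`σ ^ 2`. Its norm is controlled by the trace of `X ^ r` with `r = 2 ^ (j + 1)` of order
`(log n) ^ 2` (`norm_integral_trace_pow_le`). Only closed walks that traverse no edge exactly once
contribute to the expectation. Their total weight is bounded by a potential function
(`walkPotential`) on the initial segments of walks. An edge met for the first time at a new vertex
costs a factor `n` for the choice of the vertex; the potential charges `√n` of it to the second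
traversal of the edge. Second traversals cost nothing when there is a single edge to choose from;
the other ones lower `branchExcess`, which only increases at steps that run to a known vertex along
a new edge or along an edge already traversed at least twice. Such steps are cheap: even with the
factors `L ≥ r + 1` that pay for the choices, their weights are `L ^ 3 σ / √n` and `2 L ^ 2 τ`, both
`o(√n)`.
One step therefore multiplies the potential by at most `Q = 2 σ √n + o(√n)`
(`sum_walkPotential_cons_le`), so that `E Tr X ^ r ≤ n Q ^ r`. Markov's inequality with `r` much
larger than `log n` gives a summable bound for the probability that `‖X‖ ≥ (2 σ + δ) √n`
(`ae_eventually_coreMatrix_lt`).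
-/

/-! ### Walks and their weights -/

section Walks

variable {V : Type*}

/-- The edges traversed by a walk, with repetition. A walk is stored as the list of its vertices in
reverse order, so that the head of the list is the current position. -/
def walkEdges : List V → List (Sym2 V)
  | w :: v :: h => s(v, w) :: walkEdges (v :: h)
  | _ => []

/-- The sum of `f` over all walks obtained from `h` by `r` further steps. -/
def walkSum [Fintype V] {M : Type*} [AddCommMonoid M] (f : List V → M) : ℕ → List V → M
  | 0, h => f h
  | r + 1, h => ∑ w, walkSum f r (w :: h)

lemma mem_of_mem_walkEdges {h : List V} {x y : V} (hxy : s(x, y) ∈ walkEdges h) : y ∈ h := by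
  induction h with
  | nil => simp [walkEdges] at hxy
  | cons w t ih =>
    cases t with
    | nil => simp [walkEdges] at hxy
    | cons v t =>
      simp only [walkEdges, List.mem_cons, Sym2.eq_iff] at hxy ih ⊢
      rcases hxy with (⟨-, rfl⟩ | ⟨-, rfl⟩) | h
      · simp
      · simp
      · exact Or.inr (ih h)

variable [DecidableEq V]

/-- The number of times that the walk `h` traverses the edge `e`, in either direction. -/
def edgeCount (h : List V) (e : Sym2 V) : ℕ := (walkEdges h).count e

lemma edgeCount_singleton (v : V) (e : Sym2 V) : edgeCount [v] e = 0 := by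
  simp [edgeCount, walkEdges]

lemma edgeCount_cons (w v : V) (t : List V) (e : Sym2 V) :
    edgeCount (w :: v :: t) e = edgeCount (v :: t) e + if e = s(v, w) then 1 else 0 := by
  simp only [edgeCount, walkEdges, List.count_cons, beq_iff_eq, eq_comm (a := e)]

lemma mem_of_edgeCount_ne_zero {h : List V} {x y : V} (hxy : edgeCount h s(x, y) ≠ 0) : y ∈ h :=
  mem_of_mem_walkEdges (List.count_pos_iff.1 (Nat.pos_of_ne_zero hxy))

variable [Fintype V]

/-- The number of edges at `x` that have been traversed exactly once so far, as recorded by the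
traversal counts `c`. -/
def openDegree (c : Sym2 V → ℕ) (x : V) : ℕ := (Finset.univ.filter fun y => c s(x, y) = 1).card

/-- A measure of how far the graph of the edges traversed exactly once is from being a simple path
that ends at the current position `v`: it counts the degrees beyond `1` at `v` and beyond `2`
elsewhere (the subtraction is truncated). -/
def branchExcess (c : Sym2 V → ℕ) (v : V) : ℕ :=
  ∑ x, (openDegree c x - if x = v then 1 else 2)

/-! In the next lemmas `c'` counts the traversals after one more step of a walk and `c` those
before it. The step may be a loop. -/

lemma openDegree_eq_of_notMem {c c' : Sym2 V → ℕ} {e : Sym2 V} {x : V}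
    (hc : ∀ a, c' a = c a + if a = e then 1 else 0) (hx : x ∉ e) :
    openDegree c' x = openDegree c x := by
  have : ∀ y, c' s(x, y) = c s(x, y) := fun y => by
    rw [hc, if_neg (by rintro rfl; simp at hx), add_zero]
  simp only [openDegree, this]

lemma openDegree_eq_of_two_le {c c' : Sym2 V → ℕ} {e : Sym2 V} (x : V)
    (hc : ∀ a, c' a = c a + if a = e then 1 else 0) (h : 2 ≤ c e) :
    openDegree c' x = openDegree c x := by
  have : ∀ a, c' a = 1 ↔ c a = 1 := fun a => by
    rw [hc]; split_ifs with ha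
    · rw [ha]; omega
    · simp
  simp only [openDegree, this]

lemma openDegree_eq_add_one {c c' : Sym2 V → ℕ} {e : Sym2 V} {x : V}
    (hc : ∀ a, c' a = c a + if a = e then 1 else 0) (h : c e = 0) (hx : x ∈ e) :
    openDegree c' x = openDegree c x + 1 := by
  obtain ⟨w, rfl⟩ := hx
  have : (Finset.univ.filter fun y => c' s(x, y) = 1) =
      insert w (Finset.univ.filter fun y => c s(x, y) = 1) := by
    ext y
    simp only [hc, Finset.mem_filter, Finset.mem_univ, true_and, Finset.mem_insert,
      Sym2.congr_right]
    by_cases hy : y = w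
    · subst hy; simp [h]
    · simp [hy]
  rw [openDegree, this, Finset.card_insert_of_notMem (by simp [h]), openDegree]

lemma openDegree_add_one_eq {c c' : Sym2 V → ℕ} {e : Sym2 V} {x : V}
    (hc : ∀ a, c' a = c a + if a = e then 1 else 0) (h : c e = 1) (hx : x ∈ e) :
    openDegree c' x + 1 = openDegree c x := by
  obtain ⟨w, rfl⟩ := hx
  have : (Finset.univ.filter fun y => c s(x, y) = 1) =
      insert w (Finset.univ.filter fun y => c' s(x, y) = 1) := by
    ext y
    simp only [hc, Finset.mem_filter, Finset.mem_univ, true_and, Finset.mem_insert,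
      Sym2.congr_right]
    by_cases hy : y = w
    · subst hy; simp [h]
    · simp [hy]
  rw [openDegree, openDegree, this, Finset.card_insert_of_notMem (by simp [hc, h])]

/-- A first traversal of an edge towards a vertex without open edges, other than the current one,
does not increase the excess. -/
lemma branchExcess_le_of_fresh {c c' : Sym2 V → ℕ} {v w : V}
    (hc : ∀ a, c' a = c a + if a = s(v, w) then 1 else 0) (h : c s(v, w) = 0) (hvw : w ≠ v)
    (hw : openDegree c w = 0) : branchExcess c' w ≤ branchExcess c v := by
  refine Finset.sum_le_sum fun x _ => ?_
  by_cases hx : x ∈ s(v, w)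
  · have h1 := openDegree_eq_add_one hc h hx
    rcases Sym2.mem_iff.1 hx with rfl | rfl
    · rw [if_neg hvw.symm, if_pos rfl]; omega
    · rw [if_neg hvw, if_pos rfl]; omega
  · have h1 := openDegree_eq_of_notMem hc hx
    rw [Sym2.mem_iff, not_or] at hx
    rw [if_neg hx.1, if_neg hx.2, h1]

lemma branchExcess_le_of_zero {c c' : Sym2 V → ℕ} {v w : V}
    (hc : ∀ a, c' a = c a + if a = s(v, w) then 1 else 0) (h : c s(v, w) = 0) :
    branchExcess c' w ≤ branchExcess c v + 2 := by
  have h2 : ∑ x, (if x = w then 2 else 0) = 2 := by simp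
  refine le_trans ?_ (Nat.add_le_add_left h2.le _)
  rw [branchExcess, branchExcess, ← Finset.sum_add_distrib]
  refine Finset.sum_le_sum fun x _ => ?_
  by_cases hx : x ∈ s(v, w)
  · have h1 := openDegree_eq_add_one hc h hx
    rcases Sym2.mem_iff.1 hx with rfl | rfl <;> grind
  · have h1 := openDegree_eq_of_notMem hc hx
    rw [Sym2.mem_iff, not_or] at hx
    rw [if_neg hx.1, if_neg hx.2, h1]; omega

/-- A second traversal of an edge lowers the excess whenever there was more than one open edge to
choose from. -/
lemma branchExcess_add_le_of_one {c c' : Sym2 V → ℕ} {v w : V}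
    (hc : ∀ a, c' a = c a + if a = s(v, w) then 1 else 0) (h : c s(v, w) = 1) :
    branchExcess c' w + (if 2 ≤ openDegree c v then 1 else 0) ≤ branchExcess c v := by
  set d := openDegree c v with hd
  have h2 : ∑ x, (if x = v ∧ 2 ≤ d then 1 else 0) = if 2 ≤ d then 1 else 0 := by
    by_cases h : 2 ≤ d <;> simp [h]
  rw [← h2, branchExcess, branchExcess, ← Finset.sum_add_distrib]
  refine Finset.sum_le_sum fun x _ => ?_
  by_cases hx : x ∈ s(v, w)
  · have h1 := openDegree_add_one_eq hc h hx
    rcases Sym2.mem_iff.1 hx with rfl | rfl <;> grind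
  · have h1 := openDegree_eq_of_notMem hc hx
    rw [Sym2.mem_iff, not_or] at hx
    rw [if_neg hx.1, if_neg hx.2, if_neg (fun h => hx.1 h.1), h1]; omega

lemma branchExcess_le_of_two_le {c c' : Sym2 V → ℕ} {v w : V}
    (hc : ∀ a, c' a = c a + if a = s(v, w) then 1 else 0) (h : 2 ≤ c s(v, w)) :
    branchExcess c' w ≤ branchExcess c v + 1 := by
  have h2 : ∑ x, (if x = w then 1 else 0) = 1 := by simp
  refine le_trans ?_ (Nat.add_le_add_left h2.le _)
  rw [branchExcess, branchExcess, ← Finset.sum_add_distrib]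
  refine Finset.sum_le_sum fun x _ => ?_
  have h1 := openDegree_eq_of_two_le x hc h
  split_ifs <;> omega

/-- The weight of an edge traversed `k` times: `u` for `k = 1`, and otherwise the bound
`σ² B ^ (k - 2)` on the absolute moment of order `k` of an entry that is bounded by `B` and has
second moment at most `σ²`. -/
def multWeight (u σ B : ℝ) : ℕ → ℝ
  | 0 => 1
  | 1 => u
  | k + 2 => σ ^ 2 * B ^ k

lemma multWeight_nonneg {u σ B : ℝ} (hu : 0 ≤ u) (hB : 0 ≤ B) (k : ℕ) :
    0 ≤ multWeight u σ B k := by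
  rcases k with _ | _ | k
  · exact zero_le_one
  · exact hu
  · exact mul_nonneg (sq_nonneg σ) (pow_nonneg hB k)

lemma multWeight_zero_le {u σ B : ℝ} (hu : 0 ≤ u) (k : ℕ) :
    multWeight 0 σ B k ≤ multWeight u σ B k := by
  rcases k with _ | _ | k
  · exact le_rfl
  · exact hu
  · exact le_rfl

lemma prod_multWeight_step {u σ B : ℝ} (hu : 0 ≤ u) (hB : 0 ≤ B) {c c' : Sym2 V → ℕ}
    {e : Sym2 V} (hc : ∀ a, c' a = c a + if a = e then 1 else 0) {ρ : ℝ}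
    (hρ : multWeight u σ B (c e + 1) ≤ ρ * multWeight u σ B (c e)) :
    ∏ a, multWeight u σ B (c' a) ≤ ρ * ∏ a, multWeight u σ B (c a) := by
  rw [← Finset.mul_prod_erase _ _ (Finset.mem_univ e),
    ← Finset.mul_prod_erase _ (fun a => multWeight u σ B (c a)) (Finset.mem_univ e), ← mul_assoc]
  have h1 : ∏ a ∈ Finset.univ.erase e, multWeight u σ B (c' a) =
      ∏ a ∈ Finset.univ.erase e, multWeight u σ B (c a) :=
    Finset.prod_congr rfl fun a ha => by rw [hc, if_neg (Finset.ne_of_mem_erase ha), add_zero]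
  rw [h1, hc e, if_pos rfl]
  exact mul_le_mul_of_nonneg_right hρ (Finset.prod_nonneg fun a _ => multWeight_nonneg hu hB _)

/-- The potential of a walk that stands at `v` and has traversal counts `c`. An edge traversed once
has weight `σ / s` with `s = √n`: of the factor `n` that the choice of a new vertex costs, half is
charged to the second traversal of the edge. -/
noncomputable def walkPotential (s σ B L : ℝ) (c : Sym2 V → ℕ) (v : V) : ℝ :=
  (∏ a, multWeight (σ / s) σ B (c a)) * L ^ branchExcess c v

lemma walkPotential_nonneg {s σ B L : ℝ} (hs : 0 ≤ s) (hσ : 0 ≤ σ) (hB : 0 ≤ B) (hL : 0 ≤ L)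
    (c : Sym2 V → ℕ) (v : V) : 0 ≤ walkPotential s σ B L c v :=
  mul_nonneg (Finset.prod_nonneg fun _ _ => multWeight_nonneg (div_nonneg hσ hs) hB _)
    (pow_nonneg hL _)

lemma walkPotential_step {s σ B L : ℝ} (hs : 0 ≤ s) (hσ : 0 ≤ σ) (hB : 0 ≤ B) (hL : 1 ≤ L)
    {c c' : Sym2 V → ℕ} {v w : V} (hc : ∀ a, c' a = c a + if a = s(v, w) then 1 else 0)
    {ρ : ℝ} {k : ℕ} (hR : branchExcess c' w ≤ branchExcess c v + k)
    (hρ : multWeight (σ / s) σ B (c s(v, w) + 1) ≤ ρ * multWeight (σ / s) σ B (c s(v, w))) :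
    walkPotential s σ B L c' w ≤ ρ * L ^ k * walkPotential s σ B L c v := by
  have h1 := prod_multWeight_step (div_nonneg hσ hs) hB hc hρ
  have h2 : L ^ branchExcess c' w ≤ L ^ k * L ^ branchExcess c v := by
    rw [← pow_add, add_comm]; exact pow_le_pow_right₀ hL hR
  calc walkPotential s σ B L c' w
      ≤ (ρ * ∏ a, multWeight (σ / s) σ B (c a)) * (L ^ k * L ^ branchExcess c v) :=
        mul_le_mul h1 h2 (by positivity)
          ((Finset.prod_nonneg fun _ _ => multWeight_nonneg (div_nonneg hσ hs) hB _).trans h1)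
    _ = _ := by rw [walkPotential]; ring

/-- Each possible next position `w` is charged to one of three accounts: fresh vertices, of which
there are at most `n`; edges being traversed for the second time; and vertices met before, of which
there are at most `L`. -/
lemma walkPotential_cons_le {s σ B L : ℝ} (hs : 0 < s) (hσ : 0 ≤ σ) (hB : 0 ≤ B)
    (v w : V) (t : List V) (hL : (t.length + 1 : ℝ) ≤ L) :
    walkPotential s σ B L (edgeCount (w :: v :: t)) w ≤
      (σ / s + (if edgeCount (v :: t) s(v, w) = 1 then
          σ * s / openDegree (edgeCount (v :: t)) v else 0) +
        (if w ∈ v :: t then σ / s * L ^ 2 + L * B else 0)) *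
      walkPotential s σ B L (edgeCount (v :: t)) v := by
  set c := edgeCount (v :: t) with hcdef
  have hc := edgeCount_cons w v t
  have hL1 : 1 ≤ L := le_trans (by simp) hL
  have hL0 : 0 ≤ L := zero_le_one.trans hL1
  have hΦ := walkPotential_nonneg hs.le hσ hB hL0 c v
  have hdeg : ∀ x, (openDegree c x : ℝ) ≤ L := fun x => by
    have h1 : openDegree c x ≤ (v :: t).toFinset.card :=
      Finset.card_le_card fun y hy => by
        simp only [Finset.mem_filter, Finset.mem_univ, true_and] at hy
        exact List.mem_toFinset.2 (mem_of_edgeCount_ne_zero (by rw [← hcdef, hy]; simp))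
    have h2 : openDegree c x ≤ t.length + 1 := h1.trans (List.toFinset_card_le _)
    exact le_trans (by exact_mod_cast h2) hL
  have h0 : 0 ≤ σ / s := div_nonneg hσ hs.le
  have h1 : 0 ≤ if c s(v, w) = 1 then σ * s / openDegree c v else 0 := by
    split_ifs <;> positivity
  have h2 : 0 ≤ if w ∈ v :: t then σ / s * L ^ 2 + L * B else 0 := by
    split_ifs <;> positivity
  rcases hcw : c s(v, w) with _ | _ | k
  · have hρ : multWeight (σ / s) σ B (c s(v, w) + 1) ≤
        σ / s * multWeight (σ / s) σ B (c s(v, w)) := by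
      rw [hcw]; simp [multWeight]
    by_cases hw : w ∈ v :: t
    · refine (walkPotential_step hs.le hσ hB hL1 hc (branchExcess_le_of_zero hc hcw) hρ).trans
        (mul_le_mul_of_nonneg_right ?_ hΦ)
      rw [if_pos hw]
      rw [hcw] at h1
      have : 0 ≤ L * B := mul_nonneg hL0 hB
      linarith
    · have hdw : openDegree c w = 0 := by
        rw [openDegree, Finset.card_eq_zero, Finset.filter_eq_empty_iff]
        intro y _ hy
        rw [Sym2.eq_swap] at hy
        exact hw (mem_of_edgeCount_ne_zero (by rw [← hcdef, hy]; simp))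
      have hwv : w ≠ v := fun h => hw (by simp [h])
      refine (walkPotential_step (k := 0) hs.le hσ hB hL1 hc
        (branchExcess_le_of_fresh hc hcw hwv hdw) hρ).trans (mul_le_mul_of_nonneg_right ?_ hΦ)
      rw [hcw] at h1
      linarith
  · have hρ : multWeight (σ / s) σ B (c s(v, w) + 1) ≤
        σ * s * multWeight (σ / s) σ B (c s(v, w)) := by
      rw [hcw]; simp only [multWeight]
      exact le_of_eq (by field_simp)
    have hR := branchExcess_add_le_of_one hc hcw
    have hd : 1 ≤ openDegree c v :=
      Finset.card_pos.2 ⟨w, by simp [hcw]⟩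
    have hd0 : (0 : ℝ) < openDegree c v := by exact_mod_cast hd
    have key : walkPotential s σ B L (edgeCount (w :: v :: t)) w ≤
        σ * s / openDegree c v * walkPotential s σ B L c v := by
      have hp := prod_multWeight_step h0 hB hc hρ
      have hp0 : 0 ≤ ∏ a, multWeight (σ / s) σ B (c a) :=
        Finset.prod_nonneg fun _ _ => multWeight_nonneg h0 hB _
      have hq : L ^ branchExcess (edgeCount (w :: v :: t)) w ≤
          L ^ branchExcess c v / openDegree c v := by
        rw [le_div_iff₀ hd0]
        by_cases h2 : 2 ≤ openDegree c v
        · rw [if_pos h2] at hR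
          calc _ ≤ L ^ branchExcess (edgeCount (w :: v :: t)) w * L :=
                mul_le_mul_of_nonneg_left (hdeg v) (by positivity)
            _ = L ^ (branchExcess (edgeCount (w :: v :: t)) w + 1) := (pow_succ _ _).symm
            _ ≤ _ := pow_le_pow_right₀ hL1 hR
        · have : openDegree c v = 1 := by omega
          rw [this, Nat.cast_one, mul_one]
          exact pow_le_pow_right₀ hL1 (le_trans (Nat.le_add_right _ _) hR)
      calc _ ≤ (σ * s * ∏ a, multWeight (σ / s) σ B (c a)) *
            (L ^ branchExcess c v / openDegree c v) :=
            mul_le_mul hp hq (by positivity) (by positivity)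
        _ = _ := by rw [walkPotential]; ring
    refine key.trans (mul_le_mul_of_nonneg_right ?_ hΦ)
    rw [if_pos (by simp)]
    linarith
  · have hw : w ∈ v :: t := mem_of_edgeCount_ne_zero (x := v) (by rw [← hcdef, hcw]; simp)
    have hρ : multWeight (σ / s) σ B (c s(v, w) + 1) ≤ B * multWeight (σ / s) σ B (c s(v, w)) := by
      rw [hcw]; simp only [multWeight]
      exact le_of_eq (by ring)
    refine (walkPotential_step hs.le hσ hB hL1 hc
      (branchExcess_le_of_two_le hc (by rw [← hcdef, hcw]; omega)) hρ).trans
        (mul_le_mul_of_nonneg_right ?_ hΦ)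
    rw [hcw] at h1
    rw [if_pos hw]
    have : 0 ≤ σ / s * L ^ 2 := by positivity
    linarith

lemma sum_walkPotential_cons_le {s σ B L Q : ℝ} (hs : 0 < s) (hσ : 0 ≤ σ) (hB : 0 ≤ B)
    (hV : (Fintype.card V : ℝ) = s ^ 2) (hQ : 2 * σ * s + L ^ 3 * σ / s + L ^ 2 * B ≤ Q)
    (v : V) (t : List V) (hL : (t.length + 1 : ℝ) ≤ L) :
    ∑ w, walkPotential s σ B L (edgeCount (w :: v :: t)) w ≤
      Q * walkPotential s σ B L (edgeCount (v :: t)) v := by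
  have hL1 : 1 ≤ L := le_trans (by simp) hL
  have hL0 : 0 ≤ L := zero_le_one.trans hL1
  refine (Finset.sum_le_sum fun w _ => walkPotential_cons_le hs hσ hB v w t hL).trans ?_
  rw [← Finset.sum_mul]
  refine mul_le_mul_of_nonneg_right (le_trans ?_ hQ)
    (walkPotential_nonneg hs.le hσ hB hL0 _ v)
  rw [Finset.sum_add_distrib, Finset.sum_add_distrib, ← Finset.sum_filter, ← Finset.sum_filter,
    Finset.sum_const, Finset.sum_const, Finset.sum_const, nsmul_eq_mul, nsmul_eq_mul, nsmul_eq_mul,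
    Finset.card_univ, hV]
  have h1 : s ^ 2 * (σ / s) = σ * s := by field_simp
  have h2 : ((Finset.univ.filter fun w => edgeCount (v :: t) s(v, w) = 1).card : ℝ) *
      (σ * s / openDegree (edgeCount (v :: t)) v) ≤ σ * s := by
    rw [← openDegree]
    rcases Nat.eq_zero_or_pos (openDegree (edgeCount (v :: t)) v) with h | h
    · rw [h]; simp; positivity
    · have : (0 : ℝ) < openDegree (edgeCount (v :: t)) v := by exact_mod_cast h
      exact le_of_eq (by field_simp)
  have h3 : ((Finset.univ.filter fun w => w ∈ v :: t).card : ℝ) ≤ L := by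
    have h1 : (Finset.univ.filter fun w => w ∈ v :: t).card ≤ (v :: t).toFinset.card :=
      Finset.card_le_card fun y hy => List.mem_toFinset.2 (Finset.mem_filter.1 hy).2
    have h2 := h1.trans (List.toFinset_card_le _)
    exact le_trans (by exact_mod_cast h2) hL
  have h4 := mul_le_mul_of_nonneg_right h3
    (show 0 ≤ σ / s * L ^ 2 + L * B by positivity)
  have h5 : L * (σ / s * L ^ 2 + L * B) = L ^ 3 * σ / s + L ^ 2 * B := by ring
  linarith

/-- The total weight of the walks with `r` steps after `v :: t` in which no edge is traversed
exactly once. -/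
theorem walkSum_multWeight_le {s σ B L Q : ℝ} (hs : 0 < s) (hσ : 0 ≤ σ) (hB : 0 ≤ B)
    (hV : (Fintype.card V : ℝ) = s ^ 2) (hQ : 2 * σ * s + L ^ 3 * σ / s + L ^ 2 * B ≤ Q)
    (r : ℕ) (v : V) (t : List V) (hL : (t.length + 1 + r : ℝ) ≤ L) :
    walkSum (fun h : List V => ∏ a, multWeight 0 σ B (edgeCount h a)) r (v :: t) ≤
      Q ^ r * walkPotential s σ B L (edgeCount (v :: t)) v := by
  have hL1 : 1 ≤ L := le_trans (by have : (0 : ℝ) ≤ t.length + r := by positivity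
                                   linarith) hL
  have hQ0 : 0 ≤ Q := le_trans (by positivity) hQ
  induction r generalizing v t with
  | zero =>
    rw [pow_zero, one_mul, walkSum, walkPotential]
    have h1 : ∏ a, multWeight 0 σ B (edgeCount (v :: t) a) ≤
        ∏ a, multWeight (σ / s) σ B (edgeCount (v :: t) a) :=
      Finset.prod_le_prod (fun _ _ => multWeight_nonneg le_rfl hB _)
        fun _ _ => multWeight_zero_le (by positivity) _
    exact h1.trans (le_mul_of_one_le_right
      (Finset.prod_nonneg fun _ _ => multWeight_nonneg (by positivity) hB _)
      (one_le_pow₀ hL1))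
  | succ r ih =>
    rw [walkSum]
    calc _ ≤ ∑ w, Q ^ r * walkPotential s σ B L (edgeCount (w :: v :: t)) w :=
          Finset.sum_le_sum fun w _ => ih w (v :: t) (by push_cast at hL ⊢; simp; linarith)
      _ ≤ Q ^ r * (Q * walkPotential s σ B L (edgeCount (v :: t)) v) := by
          rw [← Finset.mul_sum]
          refine mul_le_mul_of_nonneg_left ?_ (by positivity)
          refine sum_walkPotential_cons_le hs hσ hB hV hQ v t (le_trans ?_ hL)
          have : (0 : ℝ) ≤ (r + 1 : ℕ) := by positivity
          linarith
      _ = _ := by ring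

lemma walkPotential_singleton (s σ B L : ℝ) (v : V) :
    walkPotential s σ B L (edgeCount [v]) v = 1 := by
  simp [walkPotential, branchExcess, openDegree, edgeCount_singleton, multWeight]

end Walks

/-! ### Moments of the trace of a random Hermitian matrix -/

section TraceMoment

open ComplexConjugate

/-- The Hermitian matrix with entry `x s(v, w)` in position `(v, w)` for `v ≤ w` and its conjugate
below the diagonal (on the diagonal, `x` is used as it is). -/
def hermitianOfSym2 {V : Type*} [LinearOrder V] (x : Sym2 V → ℂ) : Matrix V V ℂ :=
  Matrix.of fun v w => if v ≤ w then x s(v, w) else conj (x s(v, w))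

/-- The product of the entries of `A` along a walk (in reverse order). -/
def walkProd {V : Type*} (A : Matrix V V ℂ) : List V → ℂ
  | w :: v :: h => A w v * walkProd A (v :: h)
  | _ => 1

/-- The part of `walkProd` that comes from the edge `e`, as a function of the variable `z` attached
to that edge. -/
def walkFactor {V : Type*} [LinearOrder V] (e : Sym2 V) : List V → ℂ → ℂ
  | w :: v :: h, z => (if e = s(v, w) then (if w ≤ v then z else conj z) else 1) *
      walkFactor e (v :: h) z
  | _, _ => 1

lemma pow_apply_mul_walkProd {V : Type*} [Fintype V] [DecidableEq V] (A : Matrix V V ℂ) (u : V)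
    (r : ℕ) (v : V) (t : List V) :
    walkSum (fun h => if h.head? = some u then walkProd A h else 0) r (v :: t) =
      (A ^ r) u v * walkProd A (v :: t) := by
  induction r generalizing v t with
  | zero => simp [walkSum, Matrix.one_apply, eq_comm]
  | succ r ih =>
    simp only [walkSum, ih, walkProd, pow_succ, Matrix.mul_apply, Finset.sum_mul, mul_assoc]

lemma integrable_walkSum {V Ω : Type*} [Fintype V] [MeasurableSpace Ω] {P : Measure Ω}
    {F : List V → Ω → ℂ} (hF : ∀ h, Integrable (F h) P) (r : ℕ) (h : List V) :
    Integrable (fun ω => walkSum (fun h => F h ω) r h) P := by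
  induction r generalizing h with
  | zero => exact hF h
  | succ r ih => exact integrable_finsetSum _ fun w _ => ih (w :: h)

lemma norm_integral_walkSum_le {V Ω : Type*} [Fintype V] [MeasurableSpace Ω] {P : Measure Ω}
    {F : List V → Ω → ℂ} (hF : ∀ h, Integrable (F h) P) {G : List V → ℝ}
    (hG : ∀ h, ‖∫ ω, F h ω ∂P‖ ≤ G h) (r : ℕ) (h : List V) :
    ‖∫ ω, walkSum (fun h => F h ω) r h ∂P‖ ≤ walkSum G r h := by
  induction r generalizing h with
  | zero => exact hG h
  | succ r ih =>
    simp only [walkSum]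
    rw [integral_finsetSum _ fun w _ => integrable_walkSum hF r (w :: h)]
    exact (norm_sum_le _ _).trans (Finset.sum_le_sum fun w _ => ih (w :: h))

section

variable {V : Type*} [LinearOrder V]

lemma walkProd_hermitianOfSym2 [Fintype V] (x : Sym2 V → ℂ) (h : List V) :
    walkProd (hermitianOfSym2 x) h = ∏ e, walkFactor e h (x e) := by
  induction h with
  | nil => simp [walkProd, walkFactor]
  | cons w t ih =>
    cases t with
    | nil => simp [walkProd, walkFactor]
    | cons v t =>
      simp only [walkProd, walkFactor, Finset.prod_mul_distrib, ← ih, Finset.prod_ite_eq',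
        Finset.mem_univ, if_true]
      simp [hermitianOfSym2, Sym2.eq_swap (a := w)]

lemma measurable_walkFactor (e : Sym2 V) (h : List V) : Measurable (walkFactor e h) := by
  induction h with
  | nil => exact measurable_const
  | cons w t ih =>
    cases t with
    | nil => exact measurable_const
    | cons v t =>
      refine Measurable.mul ?_ ih
      split_ifs
      · exact measurable_id
      · exact Complex.continuous_conj.measurable
      · exact measurable_const

lemma norm_walkFactor (e : Sym2 V) (h : List V) (z : ℂ) :
    ‖walkFactor e h z‖ = ‖z‖ ^ edgeCount h e := by
  induction h with
  | nil => simp [walkFactor, edgeCount, walkEdges]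
  | cons w t ih =>
    cases t with
    | nil => simp [walkFactor, edgeCount, walkEdges]
    | cons v t =>
      rw [walkFactor, norm_mul, ih, edgeCount_cons, pow_add, mul_comm]
      split_ifs <;> simp

lemma walkFactor_of_edgeCount_eq_zero {e : Sym2 V} {h : List V} (he : edgeCount h e = 0) (z : ℂ) :
    walkFactor e h z = 1 := by
  induction h with
  | nil => rfl
  | cons w t ih =>
    cases t with
    | nil => rfl
    | cons v t =>
      rw [edgeCount_cons] at he
      rw [walkFactor, ih (by omega), if_neg (by rintro h; simp [h] at he), mul_one]

lemma walkFactor_of_edgeCount_eq_one {e : Sym2 V} {h : List V} (he : edgeCount h e = 1) :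
    (∀ z, walkFactor e h z = z) ∨ ∀ z, walkFactor e h z = conj z := by
  induction h with
  | nil => simp [edgeCount, walkEdges] at he
  | cons w t ih =>
    cases t with
    | nil => simp [edgeCount, walkEdges] at he
    | cons v t =>
      rw [edgeCount_cons] at he
      simp only [walkFactor]
      by_cases h : e = s(v, w)
      · simp only [if_pos h] at he ⊢
        simp only [walkFactor_of_edgeCount_eq_zero (by omega : edgeCount (v :: t) e = 0), mul_one]
        by_cases hwv : w ≤ v <;> simp [hwv]
      · simp only [if_neg h, one_mul] at he ⊢
        exact ih he

variable {Ω : Type*} [MeasurableSpace Ω] {P : Measure Ω} [IsProbabilityMeasure P]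

lemma norm_integral_walkFactor_le {σ B : ℝ} (hB : 0 ≤ B) {x : Ω → ℂ} (hx : Measurable x)
    (hxB : ∀ ω, ‖x ω‖ ≤ B) (hx0 : ∫ ω, x ω ∂P = 0) (hx2 : ∫ ω, ‖x ω‖ ^ 2 ∂P ≤ σ ^ 2)
    (e : Sym2 V) (h : List V) :
    ‖∫ ω, walkFactor e h (x ω) ∂P‖ ≤ multWeight 0 σ B (edgeCount h e) := by
  have hint : ∀ k : ℕ, Integrable (fun ω => ‖x ω‖ ^ k) P := fun k =>
    Integrable.of_bound (C := B ^ k) (hx.norm.pow_const k).aestronglyMeasurable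
      (.of_forall fun ω => by
        rw [norm_pow, norm_norm]; exact pow_le_pow_left₀ (norm_nonneg _) (hxB ω) k)
  rcases hk : edgeCount h e with _ | _ | k
  · simp [walkFactor_of_edgeCount_eq_zero hk, multWeight]
  · rcases walkFactor_of_edgeCount_eq_one hk with h1 | h1
    · simp [h1, hx0, multWeight]
    · simp only [h1, multWeight]
      rw [integral_conj, hx0]; simp
  · refine (norm_integral_le_integral_norm _).trans ?_
    simp only [norm_walkFactor, hk, multWeight]
    calc ∫ ω, ‖x ω‖ ^ (k + 2) ∂P ≤ ∫ ω, ‖x ω‖ ^ 2 * B ^ k ∂P := by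
          refine integral_mono (hint _) ((hint 2).mul_const _) fun ω => ?_
          simp only
          rw [add_comm, pow_add]
          exact mul_le_mul_of_nonneg_left (pow_le_pow_left₀ (norm_nonneg _) (hxB ω) k)
            (by positivity)
      _ ≤ _ := by
          rw [integral_mul_const]
          exact mul_le_mul_of_nonneg_right hx2 (by positivity)

/-- The high-moment bound: if `L ≥ r + 1` is small enough against `n`, then `Q` is close to
`2 σ √n`. -/
theorem norm_integral_trace_pow_le [Fintype V] {s σ B L Q : ℝ} (hs : 0 < s) (hσ : 0 ≤ σ)
    (hB : 0 ≤ B) (hV : (Fintype.card V : ℝ) = s ^ 2)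
    (hQ : 2 * σ * s + L ^ 3 * σ / s + L ^ 2 * B ≤ Q) {r : ℕ} (hL : (r + 1 : ℝ) ≤ L)
    {x : Sym2 V → Ω → ℂ} (hind : iIndepFun x P) (hx : ∀ e, Measurable (x e))
    (hxB : ∀ e ω, ‖x e ω‖ ≤ B) (hx0 : ∀ e, ∫ ω, x e ω ∂P = 0)
    (hx2 : ∀ e, ∫ ω, ‖x e ω‖ ^ 2 ∂P ≤ σ ^ 2) :
    Integrable (fun ω => (hermitianOfSym2 (fun e => x e ω) ^ r).trace) P ∧
    ‖∫ ω, (hermitianOfSym2 (fun e => x e ω) ^ r).trace ∂P‖ ≤ Fintype.card V * Q ^ r := by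
  set F : V → List V → Ω → ℂ := fun u h ω =>
    if h.head? = some u then walkProd (hermitianOfSym2 fun e => x e ω) h else 0 with hF
  have hprod : ∀ h, Integrable (fun ω => walkProd (hermitianOfSym2 fun e => x e ω) h) P := by
    intro h
    simp only [walkProd_hermitianOfSym2]
    refine Integrable.of_bound (C := ∏ e, B ^ edgeCount h e)
      (Finset.measurable_prod _ fun e _ =>
        (measurable_walkFactor e h).comp (hx e)).aestronglyMeasurable (.of_forall fun ω => ?_)
    rw [norm_prod]
    refine Finset.prod_le_prod (fun _ _ => norm_nonneg _) fun e _ => ?_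
    rw [norm_walkFactor]
    exact pow_le_pow_left₀ (norm_nonneg _) (hxB e ω) _
  have hFint : ∀ u h, Integrable (F u h) P := fun u h => by
    by_cases hu : h.head? = some u
    · simpa only [hF, if_pos hu] using hprod h
    · simp [hF, if_neg hu]
  have hFle : ∀ u h, ‖∫ ω, F u h ω ∂P‖ ≤ ∏ e, multWeight 0 σ B (edgeCount h e) := fun u h => by
    by_cases hu : h.head? = some u
    · simp only [hF, if_pos hu, walkProd_hermitianOfSym2]
      rw [hind.integral_fun_prod_comp (fun e => (hx e).aemeasurable)
        (fun e => (measurable_walkFactor e h).aestronglyMeasurable), norm_prod]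
      exact Finset.prod_le_prod (fun _ _ => norm_nonneg _) fun e _ =>
        norm_integral_walkFactor_le hB (hx e) (hxB e) (hx0 e) (hx2 e) e h
    · simp only [hF, if_neg hu, integral_zero, norm_zero]
      exact Finset.prod_nonneg fun e _ => multWeight_nonneg le_rfl hB _
  have htr : ∀ ω, (hermitianOfSym2 (fun e => x e ω) ^ r).trace =
      ∑ u, walkSum (fun h => F u h ω) r [u] := fun ω => by
    simp only [hF, pow_apply_mul_walkProd, Matrix.trace, Matrix.diag, walkProd, mul_one]
  simp only [htr]
  refine ⟨integrable_finsetSum _ fun u _ => integrable_walkSum (hFint u) r [u], ?_⟩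
  rw [integral_finsetSum _ fun u _ => integrable_walkSum (hFint u) r [u]]
  refine (norm_sum_le _ _).trans ?_
  have hbound : ∀ u ∈ (Finset.univ : Finset V),
      ‖∫ ω, walkSum (fun h => F u h ω) r [u] ∂P‖ ≤ Q ^ r := fun u _ => by
    refine (norm_integral_walkSum_le (hFint u) (hFle u) r [u]).trans ?_
    have := walkSum_multWeight_le hs hσ hB hV hQ r u [] (by simpa [add_comm] using hL)
    rwa [walkPotential_singleton, mul_one] at this
  refine (Finset.sum_le_card_nsmul _ _ _ hbound).trans (le_of_eq ?_)
  rw [nsmul_eq_mul, Finset.card_univ]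

end

end TraceMoment

/-! ### The spectral norm -/

section SpectralNorm

open ComplexConjugate

variable {n : ℕ}

lemma matrixSpectralNorm_add_le (A B : Matrix (Fin n) (Fin n) ℂ) :
    matrixSpectralNorm (A + B) ≤ matrixSpectralNorm A + matrixSpectralNorm B := by
  simp only [matrixSpectralNorm, map_add]
  exact norm_add_le _ _

lemma matrixSpectralNorm_smul (c : ℝ) (A : Matrix (Fin n) (Fin n) ℂ) :
    matrixSpectralNorm (c • A) = |c| * matrixSpectralNorm A := by
  have : c • A = (c : ℂ) • A := by ext; simp
  simp only [matrixSpectralNorm, this, map_smul, norm_smul, Complex.norm_real, Real.norm_eq_abs]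

lemma matrixSpectralNorm_nonneg (A : Matrix (Fin n) (Fin n) ℂ) : 0 ≤ matrixSpectralNorm A :=
  norm_nonneg _

/-- The spectral norm is at most the Frobenius norm. -/
lemma matrixSpectralNorm_sq_le_trace (A : Matrix (Fin n) (Fin n) ℂ) :
    matrixSpectralNorm A ^ 2 ≤ (A.conjTranspose * A).trace.re := by
  have htr : (A.conjTranspose * A).trace.re = ∑ i, ∑ j, ‖A i j‖ ^ 2 := by
    rw [Finset.sum_comm]
    simp only [Matrix.trace, Matrix.diag, Matrix.mul_apply, Matrix.conjTranspose_apply,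
      Complex.re_sum]
    refine Finset.sum_congr rfl fun j _ => Finset.sum_congr rfl fun i _ => ?_
    rw [RCLike.star_def, Complex.conj_mul']
    norm_cast
  rw [htr]
  have h0 : 0 ≤ ∑ i, ∑ j, ‖A i j‖ ^ 2 := by positivity
  rw [← Real.sqrt_le_sqrt_iff h0, Real.sqrt_sq (matrixSpectralNorm_nonneg A)]
  refine ContinuousLinearMap.opNorm_le_bound _ (Real.sqrt_nonneg _) fun x => ?_
  rw [EuclideanSpace.norm_eq, EuclideanSpace.norm_eq, ← Real.sqrt_mul h0]
  refine Real.sqrt_le_sqrt ?_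
  rw [Finset.sum_mul]
  refine Finset.sum_le_sum fun i _ => ?_
  rw [Matrix.ofLp_toEuclideanCLM, Matrix.mulVec, dotProduct]
  calc ‖∑ j, A i j * x j‖ ^ 2 ≤ (∑ j, ‖A i j‖ * ‖x j‖) ^ 2 := by
        refine pow_le_pow_left₀ (norm_nonneg _) ((norm_sum_le _ _).trans (le_of_eq ?_)) 2
        simp
    _ ≤ _ := Finset.sum_mul_sq_le_sq_mul_sq _ _ _

/-- Schur's test for a matrix with symmetric absolute values. -/
lemma matrixSpectralNorm_le_of_row_sum_le (A : Matrix (Fin n) (Fin n) ℂ)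
    (hA : ∀ i j, ‖A i j‖ = ‖A j i‖) {ρ : ℝ} (hρ : 0 ≤ ρ) (hrow : ∀ i, ∑ j, ‖A i j‖ ≤ ρ) :
    matrixSpectralNorm A ≤ ρ := by
  refine ContinuousLinearMap.opNorm_le_bound _ hρ fun x => ?_
  rw [EuclideanSpace.norm_eq, EuclideanSpace.norm_eq]
  conv_rhs => rw [← Real.sqrt_sq hρ]
  rw [← Real.sqrt_mul (by positivity)]
  refine Real.sqrt_le_sqrt ?_
  have key : ∀ i, ‖(Matrix.toEuclideanCLM (n := Fin n) (𝕜 := ℂ) A x) i‖ ^ 2 ≤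
      ρ * ∑ j, ‖A i j‖ * ‖x j‖ ^ 2 := fun i => by
    rw [Matrix.ofLp_toEuclideanCLM, Matrix.mulVec, dotProduct]
    calc ‖∑ j, A i j * x j‖ ^ 2 ≤ (∑ j, √‖A i j‖ * (√‖A i j‖ * ‖x j‖)) ^ 2 := by
          refine pow_le_pow_left₀ (norm_nonneg _) ((norm_sum_le _ _).trans (le_of_eq ?_)) 2
          refine Finset.sum_congr rfl fun j _ => ?_
          rw [norm_mul, ← mul_assoc, Real.mul_self_sqrt (norm_nonneg _)]
      _ ≤ (∑ j, √‖A i j‖ ^ 2) * ∑ j, (√‖A i j‖ * ‖x j‖) ^ 2 :=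
          Finset.sum_mul_sq_le_sq_mul_sq _ _ _
      _ = (∑ j, ‖A i j‖) * ∑ j, ‖A i j‖ * ‖x j‖ ^ 2 := by
          simp only [mul_pow, Real.sq_sqrt (norm_nonneg _)]
      _ ≤ _ := mul_le_mul_of_nonneg_right (hrow i) (by positivity)
  calc _ ≤ ∑ i, ρ * ∑ j, ‖A i j‖ * ‖x j‖ ^ 2 := Finset.sum_le_sum fun i _ => key i
    _ = ρ * ∑ j, (∑ i, ‖A j i‖) * ‖x j‖ ^ 2 := by
        rw [← Finset.mul_sum, Finset.sum_comm]
        simp only [Finset.sum_mul, hA]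
    _ ≤ ρ * ∑ j, ρ * ‖x j‖ ^ 2 :=
        mul_le_mul_of_nonneg_left (Finset.sum_le_sum fun j _ =>
          mul_le_mul_of_nonneg_right (hrow j) (by positivity)) hρ
    _ = _ := by rw [← Finset.mul_sum]; ring

lemma matrixSpectralNorm_pow_le_trace {A : Matrix (Fin n) (Fin n) ℂ} (hA : A.IsHermitian) (j : ℕ) :
    matrixSpectralNorm A ^ 2 ^ (j + 1) ≤ (A ^ 2 ^ (j + 1)).trace.re := by
  have h1 : matrixSpectralNorm A ^ 2 ^ j = matrixSpectralNorm (A ^ 2 ^ j) := by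
    have hT : IsSelfAdjoint (Matrix.toEuclideanCLM (n := Fin n) (𝕜 := ℂ) A) :=
      IsSelfAdjoint.map hA _
    rw [matrixSpectralNorm, matrixSpectralNorm, map_pow, hT.norm_pow_two_pow]
  have h2 : (A ^ 2 ^ j).conjTranspose * A ^ 2 ^ j = A ^ 2 ^ (j + 1) := by
    rw [(hA.pow _).eq, ← pow_add, pow_succ, mul_two]
  rw [← h2, pow_succ 2 j, pow_mul, h1]
  exact matrixSpectralNorm_sq_le_trace _

lemma isHermitian_hermitianOfSym2 {V : Type*} [LinearOrder V] {x : Sym2 V → ℂ}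
    (hx : ∀ v, conj (x s(v, v)) = x s(v, v)) : (hermitianOfSym2 x).IsHermitian := by
  refine Matrix.IsHermitian.ext fun v w => ?_
  simp only [hermitianOfSym2, Matrix.of_apply, RCLike.star_def]
  rcases lt_trichotomy v w with h | rfl | h
  · rw [if_neg h.not_ge, if_pos h.le, Complex.conj_conj, Sym2.eq_swap]
  · simp [hx]
  · rw [if_pos h.le, if_neg h.not_ge, Sym2.eq_swap]

/-- Markov's inequality applied to the trace of a power of a random Hermitian matrix. -/
theorem measure_le_matrixSpectralNorm_le {Ω : Type*} [MeasurableSpace Ω] {P : Measure Ω}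
    [IsProbabilityMeasure P] {s σ B L Q : ℝ} (hs : 0 < s) (hσ : 0 ≤ σ)
    (hB : 0 ≤ B) (hV : (n : ℝ) = s ^ 2)
    (hQ : 2 * σ * s + L ^ 3 * σ / s + L ^ 2 * B ≤ Q) {j : ℕ} (hL : (2 ^ (j + 1) + 1 : ℝ) ≤ L)
    {x : Sym2 (Fin n) → Ω → ℂ} (hind : iIndepFun x P) (hx : ∀ e, Measurable (x e))
    (hxB : ∀ e ω, ‖x e ω‖ ≤ B) (hx0 : ∀ e, ∫ ω, x e ω ∂P = 0)
    (hx2 : ∀ e, ∫ ω, ‖x e ω‖ ^ 2 ∂P ≤ σ ^ 2)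
    (hdiag : ∀ v ω, conj (x s(v, v) ω) = x s(v, v) ω) {t : ℝ} (ht : 0 < t) :
    P.real {ω | t ≤ matrixSpectralNorm (hermitianOfSym2 fun e => x e ω)} ≤
      n * (Q / t) ^ 2 ^ (j + 1) := by
  obtain ⟨hint, hle⟩ := norm_integral_trace_pow_le (r := 2 ^ (j + 1)) hs hσ hB
    (by simpa using hV) hQ (by simpa using hL) hind hx hxB hx0 hx2
  set f : Ω → ℝ := fun ω => (hermitianOfSym2 (fun e => x e ω) ^ 2 ^ (j + 1)).trace.re with hf
  have hpow : ∀ ω, matrixSpectralNorm (hermitianOfSym2 fun e => x e ω) ^ 2 ^ (j + 1) ≤ f ω :=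
    fun ω => matrixSpectralNorm_pow_le_trace (isHermitian_hermitianOfSym2 fun v => hdiag v ω) j
  have hf0 : ∀ ω, 0 ≤ f ω := fun ω => le_trans (pow_nonneg (matrixSpectralNorm_nonneg _) _) (hpow ω)
  have hmarkov := mul_meas_ge_le_integral_of_nonneg (.of_forall hf0) hint.re (t ^ 2 ^ (j + 1))
  have hI : ∫ ω, f ω ∂P ≤ n * Q ^ 2 ^ (j + 1) := by
    have h1 : ∫ ω, f ω ∂P =
        (∫ ω, (hermitianOfSym2 (fun e => x e ω) ^ 2 ^ (j + 1)).trace ∂P).re := integral_re hint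
    rw [h1]
    refine (Complex.re_le_norm _).trans (hle.trans (le_of_eq ?_))
    rw [Fintype.card_fin]
  have hsub : P.real {ω | t ≤ matrixSpectralNorm (hermitianOfSym2 fun e => x e ω)} ≤
      P.real {ω | t ^ 2 ^ (j + 1) ≤ f ω} :=
    measureReal_mono fun ω hω => (pow_le_pow_left₀ ht.le hω _).trans (hpow ω)
  rw [div_pow, mul_div_assoc', le_div_iff₀ (by positivity), mul_comm]
  exact (mul_le_mul_of_nonneg_left hsub (by positivity)).trans (hmarkov.trans hI)

end SpectralNorm

/-! ### Truncation and large entries -/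

section Truncation

/-- Hard truncation at level `τ`. -/
noncomputable def truncAt (τ : ℝ) (z : ℂ) : ℂ := if ‖z‖ ≤ τ then z else 0

lemma norm_truncAt_le {τ : ℝ} (hτ : 0 ≤ τ) (z : ℂ) : ‖truncAt τ z‖ ≤ τ := by
  unfold truncAt; split_ifs with h
  · exact h
  · simpa using hτ

lemma norm_truncAt_le_norm (τ : ℝ) (z : ℂ) : ‖truncAt τ z‖ ≤ ‖z‖ := by
  unfold truncAt; split_ifs <;> simp

lemma norm_sub_truncAt (τ : ℝ) (z : ℂ) : ‖z - truncAt τ z‖ = if τ < ‖z‖ then ‖z‖ else 0 := by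
  unfold truncAt
  by_cases h : ‖z‖ ≤ τ
  · simp [h, not_lt.2 h]
  · simp [h, not_le.1 h]

lemma measurable_truncAt (τ : ℝ) : Measurable (truncAt τ) :=
  Measurable.ite (measurableSet_le measurable_norm measurable_const) measurable_id measurable_const

variable {Ω : Type*} [MeasurableSpace Ω]

/-- The truncation of `f` at level `τ`, recentred. -/
noncomputable def truncCentered (P : Measure Ω) (τ : ℝ) (f : Ω → ℂ) (ω : Ω) : ℂ :=
  truncAt τ (f ω) - ∫ ω', truncAt τ (f ω') ∂P

variable {P : Measure Ω} [IsProbabilityMeasure P] {τ : ℝ} {f : Ω → ℂ}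

lemma integrable_truncAt (hτ : 0 ≤ τ) (hf : Measurable f) :
    Integrable (fun ω => truncAt τ (f ω)) P :=
  Integrable.of_bound (C := τ) ((measurable_truncAt τ).comp hf).aestronglyMeasurable
    (.of_forall fun _ => norm_truncAt_le hτ _)

lemma norm_truncCentered_le (hτ : 0 ≤ τ) (ω : Ω) : ‖truncCentered P τ f ω‖ ≤ 2 * τ := by
  have h1 : ‖∫ ω', truncAt τ (f ω') ∂P‖ ≤ τ := by
    simpa using norm_integral_le_of_norm_le_const (μ := P)
      (.of_forall fun ω' => norm_truncAt_le hτ (f ω'))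
  have h2 := norm_truncAt_le hτ (f ω)
  exact (norm_sub_le _ _).trans (by linarith)

lemma integral_truncCentered (hτ : 0 ≤ τ) (hf : Measurable f) :
    ∫ ω, truncCentered P τ f ω ∂P = 0 := by
  simp only [truncCentered]
  rw [integral_sub (integrable_truncAt hτ hf) (integrable_const _)]
  simp

lemma integral_norm_truncCentered_sq_le (hτ : 0 ≤ τ) (hf : Measurable f)
    (hf2 : Integrable (fun ω => ‖f ω‖ ^ 2) P) :
    ∫ ω, ‖truncCentered P τ f ω‖ ^ 2 ∂P ≤ ∫ ω, ‖f ω‖ ^ 2 ∂P := by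
  set m := ∫ ω', truncAt τ (f ω') ∂P with hm
  have hg := integrable_truncAt (P := P) hτ hf
  have hg2 : Integrable (fun ω => ‖truncAt τ (f ω)‖ ^ 2) P :=
    hf2.mono' (((measurable_truncAt τ).comp hf).norm.pow_const 2).aestronglyMeasurable
      (.of_forall fun ω => by
        rw [norm_pow, norm_norm]
        exact pow_le_pow_left₀ (norm_nonneg _) (norm_truncAt_le_norm _ _) 2)
  have hexp : ∀ ω, ‖truncCentered P τ f ω‖ ^ 2 =
      ‖truncAt τ (f ω)‖ ^ 2 - 2 * (truncAt τ (f ω) * star m).re + ‖m‖ ^ 2 := fun ω => by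
    rw [truncCentered, ← hm, Complex.sq_norm, Complex.sq_norm, Complex.sq_norm, Complex.normSq_sub]
    simp only [RCLike.star_def]; ring
  have hre : ∫ ω, (truncAt τ (f ω) * star m).re ∂P = ‖m‖ ^ 2 := by
    have h1 := integral_re (𝕜 := ℂ) (hg.mul_const (star m))
    simp only [RCLike.re_eq_complex_re] at h1
    rw [h1, integral_mul_const, ← hm, RCLike.star_def, Complex.mul_conj']
    norm_cast
  have hint : Integrable (fun ω => 2 * (truncAt τ (f ω) * star m).re) P :=
    ((hg.mul_const (star m)).re).const_mul 2
  calc ∫ ω, ‖truncCentered P τ f ω‖ ^ 2 ∂P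
      = ∫ ω, ‖truncAt τ (f ω)‖ ^ 2 ∂P - ‖m‖ ^ 2 := by
        simp only [hexp]
        rw [integral_add (show Integrable (fun ω => ‖truncAt τ (f ω)‖ ^ 2 -
            2 * (truncAt τ (f ω) * star m).re) P from hg2.sub hint) (integrable_const _),
          integral_sub hg2 hint,
          integral_const_mul, hre]
        simp; ring
    _ ≤ ∫ ω, ‖truncAt τ (f ω)‖ ^ 2 ∂P := by linarith [sq_nonneg ‖m‖]
    _ ≤ _ := integral_mono hg2 hf2 fun ω =>
        pow_le_pow_left₀ (norm_nonneg _) (norm_truncAt_le_norm _ _) 2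

lemma norm_integral_truncAt_le (hτ : 0 < τ) (hf : Measurable f) (hfi : Integrable f P)
    (hf0 : ∫ ω, f ω ∂P = 0) (hf3 : Integrable (fun ω => ‖f ω‖ ^ 3) P) {C : ℝ}
    (hC : ∫ ω, ‖f ω‖ ^ 3 ∂P ≤ C) : ‖∫ ω, truncAt τ (f ω) ∂P‖ ≤ C / τ ^ 2 := by
  have hg := integrable_truncAt (P := P) hτ.le hf
  have h1 : ∫ ω, truncAt τ (f ω) ∂P = - ∫ ω, (f ω - truncAt τ (f ω)) ∂P := by
    rw [integral_sub hfi hg, hf0]; ring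
  rw [h1, norm_neg]
  refine (norm_integral_le_integral_norm _).trans ?_
  calc ∫ ω, ‖f ω - truncAt τ (f ω)‖ ∂P ≤ ∫ ω, ‖f ω‖ ^ 3 / τ ^ 2 ∂P := by
        refine integral_mono (hfi.sub hg).norm (hf3.div_const _) fun ω => ?_
        simp only
        rw [norm_sub_truncAt]
        split_ifs with h
        · rw [le_div_iff₀ (by positivity)]
          have := pow_le_pow_left₀ hτ.le h.le 2
          calc ‖f ω‖ * τ ^ 2 ≤ ‖f ω‖ * ‖f ω‖ ^ 2 :=
                mul_le_mul_of_nonneg_left this (norm_nonneg _)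
            _ = _ := by ring
        · positivity
    _ ≤ _ := by
        rw [integral_div]
        exact div_le_div_of_nonneg_right hC (by positivity)

lemma measureReal_lt_norm_le (hτ : 0 < τ) (hf3 : Integrable (fun ω => ‖f ω‖ ^ 3) P) {C : ℝ}
    (hC : ∫ ω, ‖f ω‖ ^ 3 ∂P ≤ C) :
    P.real {ω | τ < ‖f ω‖} ≤ C / τ ^ 3 := by
  have h1 := mul_meas_ge_le_integral_of_nonneg (.of_forall fun ω => by positivity) hf3 (τ ^ 3)
  have h2 : P.real {ω | τ < ‖f ω‖} ≤ P.real {ω | τ ^ 3 ≤ ‖f ω‖ ^ 3} :=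
    measureReal_mono fun ω hω => pow_le_pow_left₀ hτ.le (le_of_lt hω) 3
  rw [le_div_iff₀ (by positivity), mul_comm]
  exact (mul_le_mul_of_nonneg_left h2 (by positivity)).trans (h1.trans hC)

end Truncation

section LargeEntries

variable {Ω : Type*} [MeasurableSpace Ω] {P : Measure Ω} [IsProbabilityMeasure P]

lemma ae_eventually_notMem_of_summable {s : ℕ → Set Ω} {u : ℕ → ℝ} (hu : Summable u)
    (h : ∀ᶠ n in atTop, P.real (s n) ≤ u n) : ∀ᵐ ω ∂P, ∀ᶠ n in atTop, ω ∉ s n := by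
  have h1 : Summable fun n => P.real (s n) :=
    Summable.of_norm_bounded_eventually_nat hu (h.mono fun n hn => by
      rwa [Real.norm_of_nonneg measureReal_nonneg])
  refine ae_eventually_notMem ?_
  have h2 := h1.tsum_ofReal_ne_top
  simpa only [ofReal_measureReal (measure_ne_top P _)] using h2

/-- The probability that some row holds at least `r` large off-diagonal entries. -/
lemma measureReal_exists_row_le {x : Sym2 ℕ → Ω → ℂ} (hind : iIndepFun x P) {τ q : ℝ}
    (hq : ∀ i j, i ≠ j → P.real {ω | τ < ‖x s(i, j) ω‖} ≤ q) (n r : ℕ) :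
    P.real {ω | ∃ i < n, r ≤ (((Finset.range n).erase i).filter
      fun j => τ < ‖x s(i, j) ω‖).card} ≤ n * (n * q) ^ r := by
  have hset : MeasurableSet {z : ℂ | τ < ‖z‖} := measurableSet_lt measurable_const measurable_norm
  have hsub : {ω | ∃ i < n, r ≤ (((Finset.range n).erase i).filter
      fun j => τ < ‖x s(i, j) ω‖).card} ⊆ ⋃ i ∈ Finset.range n,
      ⋃ S ∈ ((Finset.range n).erase i).powersetCard r,
        ⋂ j ∈ S, x s(i, j) ⁻¹' {z : ℂ | τ < ‖z‖} := by
    rintro ω ⟨i, hi, hr⟩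
    obtain ⟨S, hS, hSr⟩ := Finset.exists_subset_card_eq hr
    simp only [Set.mem_iUnion, Set.mem_iInter]
    refine ⟨i, Finset.mem_range.2 hi, S, Finset.mem_powersetCard.2
      ⟨hS.trans (Finset.filter_subset _ _), hSr⟩, fun j hj => ?_⟩
    exact (Finset.mem_filter.1 (hS hj)).2
  refine (measureReal_mono hsub (measure_ne_top P _)).trans
    ((measureReal_biUnion_finset_le _ _).trans ?_)
  have hq0 : 0 ≤ q := measureReal_nonneg.trans (hq 0 1 (by simp))
  have hrow : ∀ i ∈ Finset.range n, P.real (⋃ S ∈ ((Finset.range n).erase i).powersetCard r,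
        ⋂ j ∈ S, x s(i, j) ⁻¹' {z : ℂ | τ < ‖z‖}) ≤ (n * q) ^ r := fun i _ => by
    refine (measureReal_biUnion_finset_le _ _).trans ?_
    have hS : ∀ S ∈ ((Finset.range n).erase i).powersetCard r,
        P.real (⋂ j ∈ S, x s(i, j) ⁻¹' {z : ℂ | τ < ‖z‖}) ≤ q ^ r := fun S hS => by
      obtain ⟨hS1, hS2⟩ := Finset.mem_powersetCard.1 hS
      have hinj : Function.Injective fun j : ℕ => s(i, j) := fun a b hab =>
        Sym2.congr_right.1 hab
      have h1 := (hind.precomp hinj).measure_inter_preimage_eq_mul S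
        (sets := fun _ => {z : ℂ | τ < ‖z‖}) fun _ _ => hset
      rw [measureReal_def, h1, ENNReal.toReal_prod, ← hS2, ← Finset.prod_const]
      refine Finset.prod_le_prod (fun _ _ => ENNReal.toReal_nonneg) fun j hj => ?_
      exact hq i j (Finset.ne_of_mem_erase (hS1 hj)).symm
    refine (Finset.sum_le_card_nsmul _ _ _ hS).trans ?_
    rw [nsmul_eq_mul, mul_pow, Finset.card_powersetCard]
    refine mul_le_mul_of_nonneg_right ?_ (by positivity)
    have h1 := Nat.choose_le_pow ((Finset.range n).erase i).card r
    have h2 : ((Finset.range n).erase i).card ≤ n :=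
      (Finset.card_erase_le).trans (by simp)
    exact_mod_cast h1.trans (Nat.pow_le_pow_left h2 r)
  refine (Finset.sum_le_card_nsmul _ _ _ hrow).trans (le_of_eq ?_)
  rw [nsmul_eq_mul, Finset.card_range]

lemma sum_four_pow_indicator_le {y : ℝ} (hy : 0 ≤ y) (m : ℕ) :
    ∑ k ∈ Finset.range m, (if (4 : ℝ) ^ k < y then (4 : ℝ) ^ k else 0) ≤ 2 * y := by
  induction m with
  | zero => simpa using hy
  | succ m ih =>
    rw [Finset.sum_range_succ]
    split_ifs with h
    · have h1 : ∑ k ∈ Finset.range m, (if (4 : ℝ) ^ k < y then (4 : ℝ) ^ k else 0) ≤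
          ∑ k ∈ Finset.range m, (4 : ℝ) ^ k :=
        Finset.sum_le_sum fun k _ => by
          split_ifs
          · exact le_rfl
          · positivity
      rw [geom_sum_eq (by norm_num)] at h1
      have : (0 : ℝ) < 4 ^ m := by positivity
      linarith
    · simpa using ih

lemma summable_four_pow_mul_measureReal {Ω' : Type*} [MeasurableSpace Ω'] {P' : Measure Ω'}
    [IsProbabilityMeasure P'] {Y : Ω' → ℝ} (hY : Measurable Y) (hY0 : ∀ ω, 0 ≤ Y ω)
    (hY4 : MemLp Y 4 P') {ε : ℝ} (hε : 0 < ε) :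
    Summable fun k : ℕ => (4 : ℝ) ^ k * P'.real {ω | ε * √(2 ^ k) < Y ω} := by
  have hint : Integrable (fun ω => (Y ω / ε) ^ 4) P' := by
    have h := (hY4.integrable_norm_pow (by norm_num)).div_const (ε ^ 4)
    refine h.congr (.of_forall fun ω => ?_)
    simp [div_pow, abs_of_nonneg (hY0 ω)]
  have hiff : ∀ (k : ℕ) ω, ε * √(2 ^ k) < Y ω ↔ (4 : ℝ) ^ k < (Y ω / ε) ^ 4 := fun k ω => by
    have h1 : (4 : ℝ) ^ k = √(2 ^ k) ^ 4 := by
      rw [show (4 : ℕ) = 2 * 2 from rfl, pow_mul, Real.sq_sqrt (by positivity), ← pow_mul,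
        mul_comm, pow_mul]
      norm_num
    rw [h1, mul_comm, ← lt_div_iff₀ hε]
    exact (pow_lt_pow_iff_left₀ (Real.sqrt_nonneg _) (div_nonneg (hY0 ω) hε.le)
      (by norm_num)).symm
  refine summable_of_sum_range_le (c := ∫ ω, 2 * (Y ω / ε) ^ 4 ∂P')
    (fun k => by positivity) fun m => ?_
  have hms : ∀ k : ℕ, MeasurableSet {ω | ε * √(2 ^ k) < Y ω} := fun k =>
    measurableSet_lt measurable_const hY
  have hterm : ∀ k : ℕ, (4 : ℝ) ^ k * P'.real {ω | ε * √(2 ^ k) < Y ω} =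
      ∫ ω, {ω | ε * √(2 ^ k) < Y ω}.indicator (fun _ => (4 : ℝ) ^ k) ω ∂P' := fun k => by
    rw [integral_indicator (hms k)]; simp [mul_comm]
  simp only [hterm]
  have hi : ∀ k ∈ Finset.range m, Integrable
      (fun ω => {ω | ε * √(2 ^ k) < Y ω}.indicator (fun _ => (4 : ℝ) ^ k) ω) P' := fun k _ =>
    (integrable_const _).indicator (hms k)
  rw [← integral_finsetSum _ hi]
  refine integral_mono (integrable_finsetSum _ hi) (hint.const_mul 2) fun ω => ?_
  simp only [Set.indicator_apply, Set.mem_ofPred_eq, hiff]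
  exact sum_four_pow_indicator_le (by positivity) m

/-- All entries of the `n × n` corner are almost surely `o(√n)`. The fourth moment of `Y` is used
only here; dyadic blocks keep the union bound summable. -/
theorem ae_eventually_norm_le_mul_sqrt {Ω' : Type*} [MeasurableSpace Ω'] {P' : Measure Ω'}
    [IsProbabilityMeasure P'] (Z : ℕ → ℕ → Ω → ℂ) {Y : Ω' → ℝ} (hY : Measurable Y)
    (hY0 : ∀ ω, 0 ≤ Y ω) (hY4 : MemLp Y 4 P') {K x₀ : ℝ} {n₀ : ℕ}
    (htail : ∀ x : ℝ, x₀ < x → ∀ n : ℕ, n₀ < n →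
      1 / (n : ℝ) ^ 2 * ∑ i ∈ Finset.range n, ∑ j ∈ Finset.range n, P.real {ω | x < ‖Z i j ω‖}
        ≤ K * P'.real {ω | x < Y ω}) {ε : ℝ} (hε : 0 < ε) :
    ∀ᵐ ω ∂P, ∀ᶠ n : ℕ in atTop, ∀ i < n, ∀ j < n, ‖Z i j ω‖ ≤ ε * √n := by
  set s : ℕ → Set Ω := fun k => {ω | ∃ i < 2 ^ (k + 1), ∃ j < 2 ^ (k + 1),
    ε * √(2 ^ k) < ‖Z i j ω‖} with hs
  have hsum := (summable_four_pow_mul_measureReal hY hY0 hY4 hε).mul_left (4 * K)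
  have hbound : ∀ᶠ k in atTop, P.real (s k) ≤
      4 * K * ((4 : ℝ) ^ k * P'.real {ω | ε * √(2 ^ k) < Y ω}) := by
    have h2 : Tendsto (fun k : ℕ => (2 : ℝ) ^ k) atTop atTop :=
      tendsto_pow_atTop_atTop_of_one_lt (by norm_num)
    have h3 : Tendsto (fun k : ℕ => ε * √((2 : ℝ) ^ k)) atTop atTop :=
      (Real.tendsto_sqrt_atTop.comp h2).const_mul_atTop hε
    filter_upwards [h3.eventually_gt_atTop x₀, eventually_ge_atTop n₀] with k hk hkn
    have hn : n₀ < 2 ^ (k + 1) :=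
      hkn.trans_lt ((Nat.lt_succ_self k).trans (Nat.lt_two_pow_self))
    have h4 := htail _ hk _ hn
    have hsub : s k ⊆ ⋃ i ∈ Finset.range (2 ^ (k + 1)), ⋃ j ∈ Finset.range (2 ^ (k + 1)),
        {ω | ε * √(2 ^ k) < ‖Z i j ω‖} := by
      rintro ω ⟨i, hi, j, hj, h⟩
      simp only [Set.mem_iUnion, Finset.mem_range]
      exact ⟨i, hi, j, hj, h⟩
    have h5 : P.real (s k) ≤ ∑ i ∈ Finset.range (2 ^ (k + 1)), ∑ j ∈ Finset.range (2 ^ (k + 1)),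
        P.real {ω | ε * √(2 ^ k) < ‖Z i j ω‖} :=
      (measureReal_mono hsub (measure_ne_top P _)).trans ((measureReal_biUnion_finset_le _ _).trans
        (Finset.sum_le_sum fun i _ => measureReal_biUnion_finset_le _ _))
    have h6 : ((2 ^ (k + 1) : ℕ) : ℝ) ^ 2 = 4 * 4 ^ k := by
      push_cast
      rw [← pow_mul, mul_comm (k + 1) 2, pow_mul, pow_succ]; norm_num; ring
    rw [h6, one_div, inv_mul_le_iff₀ (by positivity)] at h4
    calc _ ≤ _ := h5.trans h4
      _ = _ := by ring
  filter_upwards [ae_eventually_notMem_of_summable hsum hbound] with ω hω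
  obtain ⟨k₀, hk₀⟩ := eventually_atTop.1 hω
  filter_upwards [eventually_ge_atTop (2 ^ k₀)] with n hn i hi j hj
  have hn0 : n ≠ 0 := by have := Nat.one_le_two_pow (n := k₀); omega
  have hk : k₀ ≤ Nat.log 2 n := Nat.le_log_of_pow_le (by norm_num) hn
  have h7 : n < 2 ^ (Nat.log 2 n + 1) := Nat.lt_pow_succ_log_self (by norm_num) n
  have h8 : 2 ^ Nat.log 2 n ≤ n := Nat.pow_log_le_self 2 hn0
  have h9 := hk₀ _ hk
  simp only [hs, Set.mem_ofPred_eq, not_exists, not_and, not_lt] at h9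
  refine (h9 i (hi.trans h7) j (hj.trans h7)).trans ?_
  exact mul_le_mul_of_nonneg_left (Real.sqrt_le_sqrt (by exact_mod_cast h8)) hε.le

end LargeEntries

/-! ### Almost sure asymptotics -/

section Growth

/-- An admissible order for the moments: it grows faster than `log n` and slower than every power
of `n`. -/
lemma exists_moment_order : ∃ j : ℕ → ℕ,
    (∀ κ : ℝ, ∀ᶠ n : ℕ in atTop, κ * (2 ^ (j n + 1) + 1 : ℝ) ^ 3 ≤ (n : ℝ) ^ (1 / 10 : ℝ)) ∧
    ∀ q : ℝ, 0 < q → q < 1 → ∀ᶠ n : ℕ in atTop,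
      (n : ℝ) * q ^ 2 ^ (j n + 1) ≤ 1 / (n : ℝ) ^ 2 := by
  -- With this choice `2 ^ (j n)` lies between `(log n) ^ 2 / 2` and `(log n) ^ 2`.
  refine ⟨fun n => Nat.log 2 ⌊Real.log n ^ 2⌋₊, fun κ => ?_, fun q hq0 hq1 => ?_⟩
  · have h1 : (fun x : ℝ => Real.log x ^ (6 : ℝ)) =o[atTop] fun x => x ^ (1 / 10 : ℝ) :=
      isLittleO_log_rpow_rpow_atTop 6 (by norm_num)
    have h2 := (h1.comp_tendsto tendsto_natCast_atTop_atTop).bound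
      (show (0 : ℝ) < 1 / (27 * (|κ| + 1)) by positivity)
    have h3 := (Real.tendsto_log_atTop.comp tendsto_natCast_atTop_atTop).eventually_ge_atTop 1
    filter_upwards [h2, h3] with n hn hy
    simp only [Function.comp_apply] at hn hy
    set y := Real.log n with hydef
    have hy6 : y ^ (6 : ℝ) = y ^ 6 := by rw [← Real.rpow_natCast]; norm_num
    rw [hy6, Real.norm_of_nonneg (by positivity), Real.norm_of_nonneg (by positivity)] at hn
    have hfl : ⌊y ^ 2⌋₊ ≠ 0 := (Nat.floor_pos.2 (by nlinarith)).ne'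
    have h4 : (2 : ℝ) ^ Nat.log 2 ⌊y ^ 2⌋₊ ≤ y ^ 2 := by
      have h5 : ((2 ^ Nat.log 2 ⌊y ^ 2⌋₊ : ℕ) : ℝ) ≤ ⌊y ^ 2⌋₊ := by
        exact_mod_cast Nat.pow_log_le_self 2 hfl
      push_cast at h5
      exact h5.trans (Nat.floor_le (by positivity))
    have h6 : (2 ^ (Nat.log 2 ⌊y ^ 2⌋₊ + 1) + 1 : ℝ) ≤ 3 * y ^ 2 := by
      rw [pow_succ]; nlinarith
    calc κ * (2 ^ (Nat.log 2 ⌊y ^ 2⌋₊ + 1) + 1 : ℝ) ^ 3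
        ≤ (|κ| + 1) * (3 * y ^ 2) ^ 3 := by
          refine mul_le_mul (by linarith [le_abs_self κ]) (pow_le_pow_left₀ (by positivity) h6 3)
            (by positivity) (by positivity)
      _ = 27 * (|κ| + 1) * y ^ 6 := by ring
      _ ≤ 27 * (|κ| + 1) * (1 / (27 * (|κ| + 1)) * (n : ℝ) ^ (1 / 10 : ℝ)) :=
          mul_le_mul_of_nonneg_left hn (by positivity)
      _ = _ := by field_simp
  · have hc : 0 < -Real.log q := neg_pos.2 (Real.log_neg hq0 hq1)
    have h3 := (Real.tendsto_log_atTop.comp tendsto_natCast_atTop_atTop).eventually_ge_atTop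
      (max 1 (3 / -Real.log q))
    filter_upwards [h3, eventually_gt_atTop 0] with n hy hn
    simp only [Function.comp_apply] at hy
    have hn0 : (0 : ℝ) < n := by exact_mod_cast hn
    set y := Real.log n with hydef
    have hy1 : 1 ≤ y := (le_max_left _ _).trans hy
    have hy2 : 3 ≤ y * -Real.log q := by
      rw [← div_le_iff₀ hc]; exact (le_max_right _ _).trans hy
    have h4 : y ^ 2 ≤ (2 ^ (Nat.log 2 ⌊y ^ 2⌋₊ + 1) : ℕ) :=
      (Nat.lt_of_floor_lt (Nat.lt_pow_succ_log_self (by norm_num) _)).le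
    have h5 : q ^ 2 ^ (Nat.log 2 ⌊y ^ 2⌋₊ + 1) ≤ 1 / (n : ℝ) ^ 3 := by
      rw [← Real.exp_log hq0, ← Real.exp_nat_mul, ← Real.exp_log hn0, ← Real.exp_nat_mul, one_div,
        ← Real.exp_neg, ← hydef, Real.exp_le_exp]
      push_cast at h4 ⊢
      nlinarith
    calc (n : ℝ) * q ^ 2 ^ (Nat.log 2 ⌊y ^ 2⌋₊ + 1) ≤ n * (1 / (n : ℝ) ^ 3) :=
          mul_le_mul_of_nonneg_left h5 hn0.le
      _ = _ := by field_simp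

/-- The scale `n ^ (1 / 10)`, in terms of which `√n` and the truncation level are integer powers. -/
noncomputable def tenthRoot (n : ℕ) : ℝ := (n : ℝ) ^ (1 / 10 : ℝ)

lemma tenthRoot_pos {n : ℕ} (hn : 0 < n) : 0 < tenthRoot n :=
  Real.rpow_pos_of_pos (by exact_mod_cast hn) _

lemma tenthRoot_pow (n : ℕ) : tenthRoot n ^ 10 = n := by
  rw [tenthRoot, ← Real.rpow_natCast, ← Real.rpow_mul (by positivity)]; norm_num

lemma sqrt_eq_tenthRoot_pow (n : ℕ) : √(n : ℝ) = tenthRoot n ^ 5 := by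
  have h : (n : ℝ) = (tenthRoot n ^ 5) ^ 2 := by rw [← pow_mul, tenthRoot_pow]
  conv_lhs => rw [h]
  exact Real.sqrt_sq (pow_nonneg (Real.rpow_nonneg (by positivity) _) 5)

lemma tendsto_tenthRoot : Tendsto tenthRoot atTop atTop :=
  (tendsto_rpow_atTop (by norm_num)).comp tendsto_natCast_atTop_atTop

end Growth

section Decomposition

open ComplexConjugate

variable {Ω : Type*}

/-- The entries of the array on and above the diagonal, indexed by unordered pairs. -/
def symEntry (Z : ℕ → ℕ → Ω → ℂ) (e : Sym2 ℕ) : Ω → ℂ := Z e.inf e.sup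

lemma apply_eq_conj {Z : ℕ → ℕ → Ω → ℂ} (hherm : ∀ n ω, (cornerMatrix Z n ω).IsHermitian)
    (i j : ℕ) (ω : Ω) : Z i j ω = conj (Z j i ω) :=
  ((hherm (max i j + 1) ω).apply ⟨i, by omega⟩ ⟨j, by omega⟩).symm

lemma symEntry_of_le (Z : ℕ → ℕ → Ω → ℂ) {i j : ℕ} (h : i ≤ j) : symEntry Z s(i, j) = Z i j := by
  simp [symEntry, h]

lemma norm_symEntry {Z : ℕ → ℕ → Ω → ℂ} (hherm : ∀ n ω, (cornerMatrix Z n ω).IsHermitian)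
    (i j : ℕ) (ω : Ω) : ‖symEntry Z s(i, j) ω‖ = ‖Z i j ω‖ := by
  rcases le_total i j with h | h
  · rw [symEntry_of_le Z h]
  · rw [Sym2.eq_swap, symEntry_of_le Z h, apply_eq_conj hherm i j, RCLike.norm_conj]

variable [MeasurableSpace Ω] {P : Measure Ω}

/-- The entries of the main part of the `n × n` corner: truncated at `τ` and recentred off the
diagonal, zero on it. -/
noncomputable def coreEntry (P : Measure Ω) (Z : ℕ → ℕ → Ω → ℂ) (τ : ℝ) (n : ℕ)
    (e : Sym2 (Fin n)) (ω : Ω) : ℂ :=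
  if e.IsDiag then 0 else truncCentered P τ (symEntry Z (e.map Fin.val)) ω

/-- The main part of the `n × n` corner. -/
noncomputable def coreMatrix (P : Measure Ω) (Z : ℕ → ℕ → Ω → ℂ) (τ : ℝ) (n : ℕ) (ω : Ω) :
    Matrix (Fin n) (Fin n) ℂ :=
  hermitianOfSym2 fun e => coreEntry P Z τ n e ω

lemma coreEntry_diag (Z : ℕ → ℕ → Ω → ℂ) (τ : ℝ) (n : ℕ) (v : Fin n) (ω : Ω) :
    coreEntry P Z τ n s(v, v) ω = 0 := by
  simp [coreEntry]

lemma isHermitian_coreMatrix (Z : ℕ → ℕ → Ω → ℂ) (τ : ℝ) (n : ℕ) (ω : Ω) :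
    (coreMatrix P Z τ n ω).IsHermitian :=
  isHermitian_hermitianOfSym2 fun v => by simp [coreEntry_diag]

lemma iIndepFun_symEntry {Z : ℕ → ℕ → Ω → ℂ}
    (hindep : iIndepFun (fun (p : {p : ℕ × ℕ // p.1 ≤ p.2}) => Z p.1.1 p.1.2) P) :
    iIndepFun (symEntry Z) P :=
  iIndepFun.precomp (f := fun p : {p : ℕ × ℕ // p.1 ≤ p.2} => Z p.1.1 p.1.2)
    (g := Sym2.sortEquiv) Sym2.sortEquiv.injective hindep

lemma measurable_symEntry {Z : ℕ → ℕ → Ω → ℂ} (hmeas : ∀ i j, Measurable (Z i j)) (e : Sym2 ℕ) :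
    Measurable (symEntry Z e) := hmeas _ _

lemma measurable_coreEntry {Z : ℕ → ℕ → Ω → ℂ} (hmeas : ∀ i j, Measurable (Z i j)) (τ : ℝ) (n : ℕ)
    (e : Sym2 (Fin n)) : Measurable (coreEntry P Z τ n e) := by
  unfold coreEntry
  split_ifs
  · exact measurable_const
  · exact ((measurable_truncAt τ).comp (measurable_symEntry hmeas _)).sub_const _

lemma iIndepFun_coreEntry {Z : ℕ → ℕ → Ω → ℂ}
    (hindep : iIndepFun (fun (p : {p : ℕ × ℕ // p.1 ≤ p.2}) => Z p.1.1 p.1.2) P) (τ : ℝ) (n : ℕ) :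
    iIndepFun (coreEntry P Z τ n) P := by
  have h1 : iIndepFun (fun e : Sym2 (Fin n) => symEntry Z (e.map Fin.val)) P :=
    (iIndepFun_symEntry hindep).precomp (Sym2.map.injective Fin.val_injective)
  refine h1.comp (fun e z => if e.IsDiag then 0 else
    truncAt τ z - ∫ ω', truncAt τ (symEntry Z (e.map Fin.val) ω') ∂P) fun e => ?_
  by_cases he : e.IsDiag
  · simp only [he, if_true]; exact measurable_const
  · simp only [he, if_false]; exact (measurable_truncAt τ).sub_const _

lemma integrable_and_integral_norm_pow_le {Z : ℕ → ℕ → Ω → ℂ} (hmeas : ∀ i j, Measurable (Z i j))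
    {p : ℕ} (hp : supOffDiagMoment P Z p ≠ ⊤) {i j : ℕ} (hij : i < j) :
    Integrable (fun ω => ‖Z i j ω‖ ^ p) P ∧
      ∫ ω, ‖Z i j ω‖ ^ p ∂P ≤ (supOffDiagMoment P Z p).toReal := by
  have h1 : ∫⁻ ω, ‖Z i j ω‖ₑ ^ p ∂P ≤ supOffDiagMoment P Z p :=
    le_iSup_of_le i (le_iSup_of_le j (le_iSup_of_le hij le_rfl))
  have h2 : ∀ ω, ENNReal.ofReal (‖Z i j ω‖ ^ p) = ‖Z i j ω‖ₑ ^ p := fun ω => by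
    rw [ENNReal.ofReal_pow (norm_nonneg _), ofReal_norm]
  have hm : Measurable fun ω => ‖Z i j ω‖ ^ p := (hmeas i j).norm.pow_const p
  have h0 : ∀ ω, 0 ≤ ‖Z i j ω‖ ^ p := fun ω => by positivity
  constructor
  · refine ⟨hm.aestronglyMeasurable, ?_⟩
    rw [hasFiniteIntegral_iff_ofReal (.of_forall h0)]
    simp only [h2]
    exact h1.trans_lt (lt_top_iff_ne_top.2 hp)
  · rw [integral_eq_lintegral_of_nonneg_ae (.of_forall h0) hm.aestronglyMeasurable]
    simp only [h2]
    exact ENNReal.toReal_mono hp h1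

/-- What the main part leaves out consists of small means, the diagonal and the large entries. If
all entries are at most `M` and no row has more than `k` large ones, its norm is small. -/
lemma matrixSpectralNorm_cornerMatrix_le {Z : ℕ → ℕ → Ω → ℂ}
    (hherm : ∀ n ω, (cornerMatrix Z n ω).IsHermitian) {τ m M : ℝ} (hm0 : 0 ≤ m) (hM0 : 0 ≤ M)
    (hm : ∀ i j, i < j → ‖∫ ω, truncAt τ (Z i j ω) ∂P‖ ≤ m) {n k : ℕ} {ω : Ω}
    (hM : ∀ i < n, ∀ j < n, ‖Z i j ω‖ ≤ M)
    (hk : ∀ i < n, (((Finset.range n).erase i).filter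
      fun j => τ < ‖symEntry Z s(i, j) ω‖).card ≤ k) :
    matrixSpectralNorm (cornerMatrix Z n ω) ≤
      matrixSpectralNorm (coreMatrix P Z τ n ω) + ((k + 1) * M + n * m) := by
  set A := cornerMatrix Z n ω - coreMatrix P Z τ n ω with hAdef
  have hA : A.IsHermitian := (hherm n ω).sub (isHermitian_coreMatrix Z τ n ω)
  have hsymm : ∀ i j, ‖A i j‖ = ‖A j i‖ := fun i j => by rw [← hA.apply i j, norm_star]
  set b : ℕ → ℕ → ℝ := fun i j => m + if τ < ‖symEntry Z s(i, j) ω‖ then M else 0 with hb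
  have hlt : ∀ i j : Fin n, i < j → ‖A i j‖ ≤ b i j := fun i j hij => by
    have h1 : A i j = (Z i j ω - truncAt τ (Z i j ω)) + ∫ ω, truncAt τ (Z i j ω) ∂P := by
      have hij' : (i : ℕ) ≤ j := hij.le
      simp only [hAdef, coreMatrix, Matrix.sub_apply, cornerMatrix, Matrix.of_apply,
        hermitianOfSym2, if_pos hij.le, coreEntry, Sym2.mk_isDiag_iff, if_neg hij.ne,
        truncCentered, Sym2.map_mk, symEntry_of_le Z hij']
      ring
    simp only [h1, hb, add_comm m]
    refine (norm_add_le _ _).trans (add_le_add ?_ (hm _ _ hij))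
    rw [norm_sub_truncAt, norm_symEntry hherm]
    split_ifs
    · exact hM _ i.2 _ j.2
    · exact le_rfl
  have hne : ∀ i j : Fin n, i ≠ j → ‖A i j‖ ≤ b i j := fun i j hij => by
    rcases lt_or_gt_of_ne hij with h | h
    · exact hlt i j h
    · have := hlt j i h
      rw [hsymm]
      simpa only [hb, Sym2.eq_swap] using this
  have hdiag : ∀ i : Fin n, ‖A i i‖ ≤ M := fun i => by
    have : A i i = Z i i ω := by
      simp [hAdef, coreMatrix, cornerMatrix, hermitianOfSym2, coreEntry_diag]
    rw [this]; exact hM _ i.2 _ i.2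
  have hrow : ∀ i, ∑ j, ‖A i j‖ ≤ (k + 1) * M + n * m := fun i => by
    have h1 : ∑ j, ‖A i j‖ ≤ ∑ j : Fin n, if (j : ℕ) = i then M else b i j := by
      refine Finset.sum_le_sum fun j _ => ?_
      by_cases h : j = i
      · subst h; simpa using hdiag j
      · rw [if_neg (fun h' => h (Fin.ext h'))]; exact hne i j (Ne.symm h)
    have h2 : ∑ j : Fin n, (if (j : ℕ) = i then M else b i j) =
        M + ∑ j ∈ (Finset.range n).erase i, b i j := by
      rw [← Finset.sum_range (fun j => if j = (i : ℕ) then M else b i j),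
        ← Finset.add_sum_erase _ _ (Finset.mem_range.2 i.2), if_pos rfl]
      congr 1
      exact Finset.sum_congr rfl fun j hj => if_neg (Finset.ne_of_mem_erase hj)
    have h3 : ∑ j ∈ (Finset.range n).erase i, b i j ≤ n * m + k * M := by
      simp only [hb]
      rw [Finset.sum_add_distrib, ← Finset.sum_filter, Finset.sum_const, Finset.sum_const,
        nsmul_eq_mul, nsmul_eq_mul]
      refine add_le_add (mul_le_mul_of_nonneg_right ?_ hm0) (mul_le_mul_of_nonneg_right ?_ hM0)
      · exact_mod_cast Finset.card_erase_le.trans (by simp)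
      · exact_mod_cast hk i i.2
    linarith
  have hn : 0 ≤ (k + 1) * M + n * m := by positivity
  have h := matrixSpectralNorm_add_le (coreMatrix P Z τ n ω) A
  rw [hAdef, add_sub_cancel] at h
  exact h.trans (by
    have := matrixSpectralNorm_le_of_row_sum_le A hsymm hn hrow
    linarith)

end Decomposition

section AlmostSure

variable {Ω : Type*} [MeasurableSpace Ω] {P : Measure Ω} [IsProbabilityMeasure P]

/-- With the truncation level `n ^ (2 / 5)`, the main part asymptotically has norm at most
`2 σ √n`. -/
theorem ae_eventually_coreMatrix_lt {Z : ℕ → ℕ → Ω → ℂ} (hmeas : ∀ i j, Measurable (Z i j))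
    (hindep : iIndepFun (fun (p : {p : ℕ × ℕ // p.1 ≤ p.2}) => Z p.1.1 p.1.2) P) {σ : ℝ}
    (hσ : 0 ≤ σ) (hint : ∀ i j, i < j → Integrable (fun ω => ‖Z i j ω‖ ^ 2) P)
    (h2 : ∀ i j, i < j → ∫ ω, ‖Z i j ω‖ ^ 2 ∂P ≤ σ ^ 2) {δ : ℝ} (hδ : 0 < δ) :
    ∀ᵐ ω ∂P, ∀ᶠ n : ℕ in atTop,
      matrixSpectralNorm (coreMatrix P Z (tenthRoot n ^ 4) n ω) < (2 * σ + δ) * √n := by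
  obtain ⟨j, hj1, hj2⟩ := exists_moment_order
  set q := (2 * σ + δ / 2) / (2 * σ + δ) with hq
  have hq0 : 0 < q := by positivity
  have hq1 : q < 1 := by rw [hq, div_lt_one (by positivity)]; linarith
  have hsum : Summable fun n : ℕ => 1 / (n : ℝ) ^ 2 :=
    Real.summable_one_div_nat_pow.2 (by norm_num)
  have hev : ∀ᶠ n : ℕ in atTop, P.real {ω | (2 * σ + δ) * √n ≤
      matrixSpectralNorm (coreMatrix P Z (tenthRoot n ^ 4) n ω)} ≤ 1 / (n : ℝ) ^ 2 := by
    filter_upwards [hj1 (8 * σ / δ), hj1 (16 / δ), hj2 q hq0 hq1, eventually_gt_atTop 0,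
      tendsto_tenthRoot.eventually_ge_atTop 1] with n hn1 hn2 hn3 hn ha1
    rw [← tenthRoot] at hn1 hn2
    set a := tenthRoot n with ha
    set L : ℝ := 2 ^ (j n + 1) + 1 with hL
    have ha0 : 0 < a := tenthRoot_pos hn
    have hL1 : 1 ≤ L := by rw [hL]; linarith [show (0 : ℝ) < 2 ^ (j n + 1) by positivity]
    have hs : √(n : ℝ) = a ^ 5 := sqrt_eq_tenthRoot_pow n
    have hV : (n : ℝ) = (a ^ 5) ^ 2 := by rw [← pow_mul, ← tenthRoot_pow n]
    have hB : 0 ≤ 2 * a ^ 4 := by positivity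
    have hQ : 2 * σ * a ^ 5 + L ^ 3 * σ / a ^ 5 + L ^ 2 * (2 * a ^ 4) ≤
        (2 * σ + δ / 2) * a ^ 5 := by
      have e1 : L ^ 3 * σ / a ^ 5 ≤ δ / 8 * a ^ 5 := by
        rw [div_le_iff₀ (by positivity)]
        have : 8 * σ / δ * L ^ 3 * (δ / 8) = L ^ 3 * σ := by field_simp
        have h1 : a ≤ a ^ 5 * a ^ 5 := by
          rw [← pow_add]; exact le_self_pow₀ ha1 (by norm_num)
        calc L ^ 3 * σ = 8 * σ / δ * L ^ 3 * (δ / 8) := this.symm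
          _ ≤ a ^ 5 * a ^ 5 * (δ / 8) :=
            mul_le_mul_of_nonneg_right (hn1.trans h1) (by positivity)
          _ = _ := by ring
      have e2 : L ^ 2 * (2 * a ^ 4) ≤ δ / 8 * a ^ 5 := by
        have h1 : L ^ 2 ≤ L ^ 3 := pow_le_pow_right₀ hL1 (by norm_num)
        have h3 : L ^ 3 * 16 ≤ a * δ := by
          calc L ^ 3 * 16 = 16 / δ * L ^ 3 * δ := by field_simp
            _ ≤ _ := mul_le_mul_of_nonneg_right hn2 hδ.le
        have : 0 ≤ a ^ 4 := by positivity
        nlinarith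
      have : 0 ≤ δ * a ^ 5 := by positivity
      linarith
    have key := measure_le_matrixSpectralNorm_le (P := P) (n := n) (by positivity) hσ hB hV hQ
      (j := j n) hL.ge (iIndepFun_coreEntry hindep (a ^ 4) n)
      (fun e => measurable_coreEntry hmeas _ n e) ?_ ?_ ?_
      (fun v ω => by simp [coreEntry_diag]) (t := (2 * σ + δ) * a ^ 5) (by positivity)
    · rw [hs]
      refine key.trans (le_trans (le_of_eq ?_) hn3)
      rw [mul_div_mul_right _ _ (by positivity)]
    · intro e ω
      unfold coreEntry
      split_ifs
      · simpa using hB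
      · exact norm_truncCentered_le (by positivity) ω
    · intro e
      unfold coreEntry
      split_ifs
      · simp
      · exact integral_truncCentered (by positivity) (measurable_symEntry hmeas _)
    · intro e
      unfold coreEntry
      split_ifs with he
      · simp; positivity
      · have hlt : (e.map Fin.val).inf < (e.map Fin.val).sup := by
          induction e with
          | _ v w =>
            simp only [Sym2.mk_isDiag_iff] at he
            simpa [eq_comm] using he
        exact (integral_norm_truncCentered_sq_le (by positivity) (measurable_symEntry hmeas _)
          (hint _ _ hlt)).trans (h2 _ _ hlt)
  filter_upwards [ae_eventually_notMem_of_summable hsum hev] with ω hω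
  filter_upwards [hω] with n hn
  exact not_le.1 hn

/-- With the truncation level `n ^ (2 / 5)`, the large entries are so sparse that almost surely
every row of the `n × n` corner has at most `14` of them for large `n`. -/
theorem ae_eventually_card_large_le {Z : ℕ → ℕ → Ω → ℂ}
    (hindep : iIndepFun (fun (p : {p : ℕ × ℕ // p.1 ≤ p.2}) => Z p.1.1 p.1.2) P)
    (hint : ∀ i j, i < j → Integrable (fun ω => ‖Z i j ω‖ ^ 3) P) {C : ℝ}
    (hC : ∀ i j, i < j → ∫ ω, ‖Z i j ω‖ ^ 3 ∂P ≤ C) :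
    ∀ᵐ ω ∂P, ∀ᶠ n : ℕ in atTop, ∀ i < n, (((Finset.range n).erase i).filter
      fun j => tenthRoot n ^ 4 < ‖symEntry Z s(i, j) ω‖).card ≤ 14 := by
  have hsum : Summable fun n : ℕ => C ^ 15 * (1 / (n : ℝ) ^ 2) :=
    (Real.summable_one_div_nat_pow.2 (by norm_num)).mul_left _
  have hev : ∀ᶠ n : ℕ in atTop, P.real {ω | ∃ i < n, 15 ≤ (((Finset.range n).erase i).filter
      fun j => tenthRoot n ^ 4 < ‖symEntry Z s(i, j) ω‖).card} ≤ C ^ 15 * (1 / (n : ℝ) ^ 2) := by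
    filter_upwards [eventually_gt_atTop 0] with n hn
    have ha0 : 0 < tenthRoot n := tenthRoot_pos hn
    have hq : ∀ i j, i ≠ j → P.real {ω | tenthRoot n ^ 4 < ‖symEntry Z s(i, j) ω‖} ≤
        C / (tenthRoot n ^ 4) ^ 3 := fun i j hij => by
      have hlt : s(i, j).inf < s(i, j).sup := by simpa using hij.symm
      exact measureReal_lt_norm_le (by positivity) (hint _ _ hlt) (hC _ _ hlt)
    -- The number of rows times the `15`-th power of the mean number `C n ^ (-1 / 5)` of large
    -- entries in a row: `15` is the least exponent for which this is `O(n ^ (-2))`.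
    refine (measureReal_exists_row_le (iIndepFun_symEntry hindep) hq n 15).trans (le_of_eq ?_)
    rw [← tenthRoot_pow n]
    field_simp
  filter_upwards [ae_eventually_notMem_of_summable hsum hev] with ω hω
  filter_upwards [hω] with n hn i hi
  by_contra h
  exact hn ⟨i, hi, by omega⟩

end AlmostSure

theorem mainTheorem7 {Ω Ω' : Type*} [MeasurableSpace Ω] [MeasurableSpace Ω']
    (P : Measure Ω) [IsProbabilityMeasure P] (P' : Measure Ω') [IsProbabilityMeasure P']
    (Z : ℕ → ℕ → Ω → ℂ)
    (hmeas : ∀ i j, Measurable (Z i j))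
    (hherm : ∀ n ω, (cornerMatrix Z n ω).IsHermitian)
    (hindep : iIndepFun (fun (p : {p : ℕ × ℕ // p.1 ≤ p.2}) => Z p.1.1 p.1.2) P)
    (hcent : ∀ i j, Integrable (Z i j) P ∧ ∫ ω, Z i j ω ∂P = 0)
    (hthird : supOffDiagMoment P Z 3 < ⊤)
    (Y : Ω' → ℝ) (hYmeas : Measurable Y) (hYnonneg : ∀ ω, 0 ≤ Y ω) (hYfourth : MemLp Y 4 P')
    (K : ℝ) (hK : 0 < K) (x₀ : ℝ) (hx₀ : 0 < x₀) (n₀ : ℕ) (hn₀ : 0 < n₀)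
    (htail : ∀ x : ℝ, x₀ < x → ∀ n : ℕ, n₀ < n →
      1 / (n : ℝ) ^ 2 * ∑ i ∈ Finset.range n, ∑ j ∈ Finset.range n, P.real {ω | x < ‖Z i j ω‖}
        ≤ K * P'.real {ω | x < Y ω}) :
    ∀ᵐ ω ∂P,
      limsup (fun n : ℕ =>
        ENNReal.ofReal (matrixSpectralNorm ((√(n : ℝ))⁻¹ • cornerMatrix Z n ω))) atTop
        ≤ 2 * sigmaStar P Z := by
  -- In this case `sigmaStar P Z = ⊤` and the bound holds trivially.
  by_cases h2top : supOffDiagMoment P Z 2 = ⊤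
  · have : sigmaStar P Z = ⊤ := by
      rw [sigmaStar, h2top, ENNReal.top_rpow_of_pos (by norm_num)]
    refine .of_forall fun ω => ?_
    rw [this, ENNReal.mul_top (by norm_num)]
    exact le_top
  have hσtop : sigmaStar P Z ≠ ⊤ := ENNReal.rpow_ne_top_of_nonneg (by norm_num) h2top
  set σ := (sigmaStar P Z).toReal with hσdef
  have hσ0 : 0 ≤ σ := ENNReal.toReal_nonneg
  have hσsq : (supOffDiagMoment P Z 2).toReal = σ ^ 2 := by
    rw [hσdef, sigmaStar, ← ENNReal.toReal_pow, ← ENNReal.rpow_natCast, ← ENNReal.rpow_mul]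
    norm_num
  set C := (supOffDiagMoment P Z 3).toReal with hCdef
  have hC0 : 0 ≤ C := ENNReal.toReal_nonneg
  have hm2 := fun i j (hij : i < j) => integrable_and_integral_norm_pow_le hmeas h2top hij
  have hm3 := fun i j (hij : i < j) => integrable_and_integral_norm_pow_le hmeas hthird.ne hij
  have key : ∀ δ : ℝ, 0 < δ → ∀ᵐ ω ∂P, ∀ᶠ n : ℕ in atTop,
      matrixSpectralNorm ((√(n : ℝ))⁻¹ • cornerMatrix Z n ω) ≤ 2 * σ + 3 * δ := by
    intro δ hδ
    filter_upwards [ae_eventually_coreMatrix_lt hmeas hindep hσ0 (fun i j hij => (hm2 i j hij).1)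
        (fun i j hij => hσsq ▸ (hm2 i j hij).2) hδ,
      ae_eventually_card_large_le hindep (fun i j hij => (hm3 i j hij).1)
        (fun i j hij => (hm3 i j hij).2),
      ae_eventually_norm_le_mul_sqrt Z hYmeas hYnonneg hYfourth htail
        (show 0 < δ / 15 by positivity)] with ω h1 h2 h3
    filter_upwards [h1, h2, h3, eventually_gt_atTop 0, tendsto_tenthRoot.eventually_ge_atTop 1,
      tendsto_tenthRoot.eventually_ge_atTop (C / δ)] with n h1 h2 h3 hn ha1 haC
    have ha0 := tenthRoot_pos hn
    have hm : ∀ i j, i < j → ‖∫ ω, truncAt (tenthRoot n ^ 4) (Z i j ω) ∂P‖ ≤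
        C / (tenthRoot n ^ 4) ^ 2 := fun i j hij =>
      norm_integral_truncAt_le (by positivity) (hmeas i j) (hcent i j).1 (hcent i j).2
        (hm3 i j hij).1 (hm3 i j hij).2
    have h4 := matrixSpectralNorm_cornerMatrix_le hherm (by positivity) (by positivity) hm h3 h2
    -- The means are at most `C n ^ (-4 / 5)`, so their row sums are at most `C n ^ (1 / 5)`.
    have h5 : (n : ℝ) * (C / (tenthRoot n ^ 4) ^ 2) ≤ δ * √n := by
      rw [sqrt_eq_tenthRoot_pow, ← tenthRoot_pow n]
      have h6 : C ≤ tenthRoot n * δ := (div_le_iff₀ hδ).1 haC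
      have h7 : tenthRoot n ^ 10 * (C / (tenthRoot n ^ 4) ^ 2) = tenthRoot n ^ 2 * C := by
        field_simp
      have h8 : tenthRoot n ^ 3 ≤ tenthRoot n ^ 5 := pow_le_pow_right₀ ha1 (by norm_num)
      rw [tenthRoot_pow, ← tenthRoot_pow n, h7]
      calc tenthRoot n ^ 2 * C ≤ tenthRoot n ^ 2 * (tenthRoot n * δ) :=
            mul_le_mul_of_nonneg_left h6 (by positivity)
        _ = δ * tenthRoot n ^ 3 := by ring
        _ ≤ _ := mul_le_mul_of_nonneg_left h8 hδ.le
    have hs : 0 < √(n : ℝ) := Real.sqrt_pos.2 (by exact_mod_cast hn)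
    rw [matrixSpectralNorm_smul, abs_of_pos (by positivity), inv_mul_le_iff₀ hs]
    push_cast at h4
    linarith
  have hseq : ∀ᵐ ω ∂P, ∀ m : ℕ, ∀ᶠ n : ℕ in atTop,
      matrixSpectralNorm ((√(n : ℝ))⁻¹ • cornerMatrix Z n ω) ≤ 2 * σ + 3 * (1 / (m + 1 : ℝ)) :=
    ae_all_iff.2 fun m => key _ (by positivity)
  filter_upwards [hseq] with ω hω
  have hlim : Tendsto (fun m : ℕ => ENNReal.ofReal (2 * σ + 3 * (1 / (m + 1 : ℝ)))) atTop
      (nhds (ENNReal.ofReal (2 * σ + 3 * 0))) :=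
    ENNReal.tendsto_ofReal (tendsto_const_nhds.add
      (tendsto_one_div_add_atTop_nhds_zero_nat.const_mul 3))
  have hfin : ENNReal.ofReal (2 * σ + 3 * 0) = 2 * sigmaStar P Z := by
    rw [mul_zero, add_zero, ENNReal.ofReal_mul (by norm_num), hσdef, ENNReal.ofReal_toReal hσtop]
    norm_num
  rw [← hfin]
  refine ge_of_tendsto' hlim fun m => limsup_le_of_le (by isBoundedDefault) ?_
  filter_upwards [hω m] with n hn
  exact ENNReal.ofReal_le_ofReal hn
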